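/- Let $D$ be an integral domain (commutative, with unit; a field is allowed) with fraction field $K$. An ideal $I$ of $D$ is invertible if $IB=D$ for some fractional ideal $B$ of $D$. An MNI ideal of $D$ is an ideal that is maximal among the nonzero non-invertible ideals of $D$. The domain $D$ is h-local if every nonzero ideal of $D$ is contained in at most finitely many maximal ideals and every nonzero prime ideal of $D$ is contained in a unique maximal ideal. A domain $R$ is a pseudo-valuation domain (PVD) if it has a unique maximal ideal $M$ and the ring $M:M=\{x\in \mathrm{Frac}(R) : xM\subseteq M\}$ is a valuation domain with maximal ideal $M$; $R$ is two-generated if each of its ideals can be generated by two elements. The domain $D$ is a GMPD domain (globalized multiplicatively pinched-Dedekind domain) if $D$ is h-local and, for each maximal ideal $M$ of $D$, the localization $D_M$ is a two-generated PVD, or a valuation domain with value group $\mathbb{Z}\times\mathbb{Z}$ (ordered lexicographically), or a valuation domain with value group $\mathbb{R}$ (with its usual order), value groups being taken up to isomorphism of ordered groups. **Theorem.** $D$ is a GMPD domain if and only if every nonzero non-invertible ideal $I$ of $D$ can be written as $I=JP_1\cdots P_k$ with $J$ an invertible (integral) ideal of $D$, possibly $J=D$, and $P_1,\dots,P_k$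 distinct MNI ideals of $D$. -/

import Mathlib

open scoped nonZeroDivisors

/-- An ideal `I` of a domain `D` is invertible if it is a unit in the monoid of fractional ideals
of `D`, i.e. `I * B = D` for some fractional ideal `B`. -/
def IsInvertibleIdeal {D : Type*} [CommRing D] [IsDomain D] (I : Ideal D) : Prop :=
  IsUnit (I : FractionalIdeal D⁰ (FractionRing D))

/-- An MNI ideal: an ideal maximal among the nonzero non-invertible ideals. -/
def IsMNI {D : Type*} [CommRing D] [IsDomain D] (P : Ideal D) : Prop :=
  Maximal (fun I : Ideal D => I ≠ ⊥ ∧ ¬ IsInvertibleIdeal I) P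

/-- `D` is h-local: every nonzero ideal lies in at most finitely many maximal ideals, and every
nonzero prime ideal lies in a unique maximal ideal. -/
def IsHLocal (D : Type*) [CommRing D] : Prop :=
  (∀ I : Ideal D, I ≠ ⊥ → {M : Ideal D | M.IsMaximal ∧ I ≤ M}.Finite) ∧
    ∀ P : Ideal D, P.IsPrime → P ≠ ⊥ → ∃! M : Ideal D, M.IsMaximal ∧ P ≤ M

/-- The image of an ideal of `D` in the fraction field of `D`. -/
def idealImage {D : Type*} [CommRing D] (I : Ideal D) : Set (FractionRing D) :=
  algebraMap D (FractionRing D) '' (I : Set D)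

/-- The ring `I : I = {x ∈ K | x I ⊆ I}`, where `K` is the fraction field of `D`. -/
def colonRing {D : Type*} [CommRing D] (I : Ideal D) : Subring (FractionRing D) where
  carrier := {x | ∀ y ∈ idealImage I, x * y ∈ idealImage I}
  one_mem' := fun y hy => by simpa using hy
  mul_mem' := fun {a b} ha hb y hy => by
    rw [mul_assoc]
    exact ha _ (hb y hy)
  zero_mem' := fun y _ => ⟨0, I.zero_mem, by simp⟩
  add_mem' := fun {a b} ha hb y hy => by
    obtain ⟨u, hu, hu'⟩ := ha y hy
    obtain ⟨v, hv, hv'⟩ := hb y hy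
    exact ⟨u + v, I.add_mem hu hv, by rw [map_add, hu', hv', add_mul]⟩
  neg_mem' := fun {a} ha y hy => by
    obtain ⟨u, hu, hu'⟩ := ha y hy
    exact ⟨-u, I.neg_mem hu, by rw [map_neg, hu', neg_mul]⟩

/-- `R` is a pseudo-valuation domain: `R` is quasi-local and, `M` being its maximal ideal, the ring
`M : M` is a valuation domain with maximal ideal `M`. -/
def IsPVD (R : Type*) [CommRing R] [IsDomain R] : Prop :=
  ∃ _ : IsLocalRing R,
    ValuationRing (colonRing (IsLocalRing.maximalIdeal R)) ∧
      ∃ N : Ideal (colonRing (IsLocalRing.maximalIdeal R)), N.IsMaximal ∧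
        Subtype.val '' (N : Set (colonRing (IsLocalRing.maximalIdeal R))) =
          idealImage (IsLocalRing.maximalIdeal R)

/-- Every ideal can be generated by two elements. -/
def IsTwoGenerated (R : Type*) [CommRing R] : Prop :=
  ∀ I : Ideal R, ∃ a b : R, I = Ideal.span {a, b}

/-- `R` is a valuation domain whose value group is isomorphic, as an ordered group, to the
(additively written) ordered group `Γ`. Mathlib writes value groups multiplicatively and adjoins
a zero to them. -/
def IsValuationDomainWithValueGroup (R : Type*) [CommRing R] [IsDomain R]
    (Γ : Type*) [AddCommGroup Γ] [LinearOrder Γ] [IsOrderedAddMonoid Γ] : Prop :=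
  ∃ _ : ValuationRing R,
    Nonempty (ValuationRing.ValueGroup R (FractionRing R) ≃*o WithZero (Multiplicative Γ))

/-- Globalized multiplicatively pinched-Dedekind domains. `ℤ ×ₗ ℤ` is `ℤ × ℤ` with the
lexicographic order. -/
def IsGMPD (D : Type*) [CommRing D] [IsDomain D] : Prop :=
  IsHLocal D ∧
    ∀ (M : Ideal D) [M.IsMaximal],
      (IsTwoGenerated (Localization.AtPrime M) ∧ IsPVD (Localization.AtPrime M)) ∨
        IsValuationDomainWithValueGroup (Localization.AtPrime M) (ℤ ×ₗ ℤ) ∨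
        IsValuationDomainWithValueGroup (Localization.AtPrime M) ℝ

/-!
Call a non-principal prime ideal `Q` of a local domain a *pinching ideal* if every non-principal
ideal is a multiple `yQ`. The proof passes through this local notion: both sides of the equivalence
say that `D` is h-local and that, for each maximal ideal `M`, the localization `D_M` is a principal
ideal ring or has a pinching ideal.

*Local structure.* Let `Q` be a pinching ideal of the local domain `R` with maximal ideal `M`.
If `Q ≠ M`, then `M = (π)`, `Q` is the intersection of the powers of `(π)`, and `Q` is generated by
some `p` after inverting `π`; every nonzero element is a unit times `π ^ a p ^ b`, and the value
group is `ℤ × ℤ`. If `Q = M` is finitely generated, then `M` has two generators and every ideal of `R` is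
principal or a multiple of `V = M : M`, which is a valuation ring with maximal ideal `M`. If `Q = M`
is not finitely generated, then `R` is a valuation ring whose value group is a dense subgroup of `ℝ`
closed under infima, so it is `ℝ`. Conversely, the local domains of the three kinds are principal
or have a pinching ideal. See `isTwoGenerated_and_isPVD_or` and
`isPrincipalIdealRing_or_isPinchingIdeal`.

*From factorizations to h-locality.* MNI ideals are prime. Under the factorization property nonzero
non-invertible primes are MNI and invertible primes are maximal. The key step is
`HasMNIFactorization.isInvertibleIdeal_localContraction`: the ideals `x D_M ∩ D` are invertible. Both
conditions of h-locality follow from it. A maximal ideal contains at most one MNI ideal, and this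
ideal generates the pinching ideal of `D_M`.

*From h-locality to factorizations.* In an h-local domain a nonzero ideal `I` is the product of the
contractions `I D_M ∩ D` over the finitely many maximal ideals `M` that contain it. The contraction
is `x D_M ∩ D`, a factor of the principal ideal `(x)` and so invertible, or it is the product of such
an ideal and of the contraction of the pinching ideal of `D_M`, which is an MNI ideal.
-/

/-! ### Invertible ideals and MNI ideals -/

section Invertible

variable {D : Type*} [CommRing D] [IsDomain D]

theorem isInvertibleIdeal_iff {I : Ideal D} :
    IsInvertibleIdeal I ↔ ∃ (B : Ideal D) (c : D), c ≠ 0 ∧ I * B = Ideal.span {c} := by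
  unfold IsInvertibleIdeal
  constructor
  · rintro h
    obtain ⟨F, hF⟩ := h.exists_right_inv
    obtain ⟨c, B, hc, rfl⟩ := FractionalIdeal.exists_eq_spanSingleton_mul F
    refine ⟨B, c, hc, ?_⟩
    have hc' : algebraMap D (FractionRing D) c ≠ 0 := by simpa using hc
    have h2 : ((I * B : Ideal D) : FractionalIdeal D⁰ (FractionRing D)) =
        ((Ideal.span {c} : Ideal D) : FractionalIdeal D⁰ (FractionRing D)) := by
      rw [FractionalIdeal.coeIdeal_mul, FractionalIdeal.coeIdeal_span_singleton]
      calc (I : FractionalIdeal D⁰ (FractionRing D)) * B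
          = FractionalIdeal.spanSingleton D⁰ (algebraMap D (FractionRing D) c) *
            ((I : FractionalIdeal D⁰ (FractionRing D)) *
              (FractionalIdeal.spanSingleton D⁰ (algebraMap D (FractionRing D) c)⁻¹ * B)) := by
            have : FractionalIdeal.spanSingleton D⁰ (algebraMap D (FractionRing D) c) *
              FractionalIdeal.spanSingleton D⁰ (algebraMap D (FractionRing D) c)⁻¹ = 1 := by
              rw [FractionalIdeal.spanSingleton_mul_spanSingleton, mul_inv_cancel₀ hc',
                FractionalIdeal.spanSingleton_one]
            calc _ = 1 * ((I : FractionalIdeal D⁰ (FractionRing D)) * B) := by rw [one_mul]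
              _ = _ := by rw [← this]; ring
        _ = _ := by rw [hF, mul_one]
    exact FractionalIdeal.coeIdeal_injective h2
  · rintro ⟨B, c, hc, h⟩
    have hc' : algebraMap D (FractionRing D) c ≠ 0 := by simpa using hc
    have h2 : (I : FractionalIdeal D⁰ (FractionRing D)) * B =
        FractionalIdeal.spanSingleton D⁰ (algebraMap D (FractionRing D) c) := by
      rw [← FractionalIdeal.coeIdeal_mul, h, FractionalIdeal.coeIdeal_span_singleton]
    refine IsUnit.of_mul_eq_one
      (B * FractionalIdeal.spanSingleton D⁰ (algebraMap D (FractionRing D) c)⁻¹) ?_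
    rw [← mul_assoc, h2, FractionalIdeal.spanSingleton_mul_spanSingleton, mul_inv_cancel₀ hc',
                FractionalIdeal.spanSingleton_one]

theorem isInvertibleIdeal_mul_iff {I J : Ideal D} :
    IsInvertibleIdeal (I * J) ↔ IsInvertibleIdeal I ∧ IsInvertibleIdeal J := by
  unfold IsInvertibleIdeal
  rw [FractionalIdeal.coeIdeal_mul, IsUnit.mul_iff]

theorem isInvertibleIdeal_top : IsInvertibleIdeal (⊤ : Ideal D) :=
  isInvertibleIdeal_iff.2 ⟨⊤, 1, one_ne_zero, by simp⟩

theorem isInvertibleIdeal_prod {ι : Type*} (s : Finset ι) (J : ι → Ideal D)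
    (h : ∀ i ∈ s, IsInvertibleIdeal (J i)) : IsInvertibleIdeal (∏ i ∈ s, J i) :=
  Finset.prod_induction _ IsInvertibleIdeal (fun _ _ ha hb => isInvertibleIdeal_mul_iff.2 ⟨ha, hb⟩)
    (by simpa using isInvertibleIdeal_top) h

theorem isInvertibleIdeal_span_singleton {c : D} (hc : c ≠ 0) :
    IsInvertibleIdeal (Ideal.span {c}) :=
  isInvertibleIdeal_iff.2 ⟨⊤, c, hc, by simp⟩

namespace IsInvertibleIdeal

variable {A X Y : Ideal D}

theorem of_mul_eq_span {c : D} (hc : c ≠ 0) (h : A * X = Ideal.span {c}) : IsInvertibleIdeal A :=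
  isInvertibleIdeal_iff.2 ⟨X, c, hc, h⟩

theorem mul_le_mul_left_iff (hA : IsInvertibleIdeal A) : A * X ≤ A * Y ↔ X ≤ Y := by
  refine ⟨fun h => ?_, fun h => Ideal.mul_mono_right h⟩
  obtain ⟨B, c, hc, hB⟩ := isInvertibleIdeal_iff.1 hA
  have h1 : Ideal.span {c} * X ≤ Ideal.span {c} * Y := by
    rw [← hB, mul_comm A B, mul_assoc, mul_assoc]; exact Ideal.mul_mono_right h
  exact (Ideal.span_singleton_mul_right_mono hc).1 h1

theorem mul_left_cancel (hA : IsInvertibleIdeal A) (h : A * X = A * Y) : X = Y :=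
  le_antisymm (hA.mul_le_mul_left_iff.1 h.le) (hA.mul_le_mul_left_iff.1 h.ge)

theorem eq_top_of_mul_eq (hA : IsInvertibleIdeal A) (h : X * A = A) : X = ⊤ :=
  hA.mul_left_cancel (by rw [mul_comm, h, Ideal.mul_top])

theorem exists_eq_mul_of_le (hA : IsInvertibleIdeal A) (h : X ≤ A) : ∃ Y, X = A * Y := by
  obtain ⟨B, c, hc, hB⟩ := isInvertibleIdeal_iff.1 hA
  have h1 : B * X ≤ Ideal.span {c} := by
    rw [← hB, mul_comm A B]; exact Ideal.mul_mono_right h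
  -- `Y = c⁻¹ B X`, an integral ideal since `B X ⊆ (c)`
  let Y : Ideal D := Submodule.comap (LinearMap.lsmul D D c) (B * X)
  have hY : B * X = Ideal.span {c} * Y := by
    refine (Ideal.eq_span_singleton_mul _ _).2 ⟨fun z hz => ?_, fun z hz => hz⟩
    obtain ⟨w, rfl⟩ := Ideal.mem_span_singleton.1 (h1 hz)
    exact ⟨w, hz, rfl⟩
  refine ⟨Y, (isInvertibleIdeal_span_singleton hc).mul_left_cancel ?_⟩
  rw [← mul_assoc, mul_comm _ A, mul_assoc, ← hY, ← mul_assoc, hB]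

theorem ne_bot (hA : IsInvertibleIdeal A) : A ≠ ⊥ := by
  rintro rfl
  obtain ⟨B, c, hc, hB⟩ := isInvertibleIdeal_iff.1 hA
  rw [Ideal.bot_mul, eq_comm, Ideal.span_singleton_eq_bot] at hB
  exact hc hB

/-- Invertible ideals of local domains are principal. -/
theorem exists_eq_span [IsLocalRing D] (hA : IsInvertibleIdeal A) :
    ∃ a, a ≠ 0 ∧ A = Ideal.span {a} := by
  have hfin : {I : Ideal D | I.IsMaximal}.Finite :=
    (Set.finite_singleton (IsLocalRing.maximalIdeal D)).subset
      fun I hI => IsLocalRing.eq_maximalIdeal hI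
  obtain ⟨a, ha⟩ := Ideal.IsPrincipal.of_finite_maximals_of_isUnit hfin hA
  refine ⟨a, ?_, ha⟩
  rintro rfl
  exact hA.ne_bot (by simpa using ha)

/-- A prime ideal properly contained in an invertible ideal `A` is unchanged by multiplication
with `A`. In `P = AY` the factor `Y` lies in `P`, since `A` does not. -/
theorem mul_eq_of_isPrime {P : Ideal D} (hA : IsInvertibleIdeal A) (hP : P.IsPrime)
    (h : P < A) : A * P = P := by
  obtain ⟨Y, hY⟩ := hA.exists_eq_mul_of_le h.le
  refine le_antisymm Ideal.mul_le_right ?_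
  have : Y ≤ P := ((hP.mul_le.1 hY.ge).resolve_left h.not_ge)
  calc P = A * Y := hY
    _ ≤ A * P := Ideal.mul_mono_right this

/-- No proper invertible ideal strictly contains an invertible prime ideal. -/
theorem eq_top_of_isPrime_lt {P : Ideal D} (hA : IsInvertibleIdeal A) (hP : P.IsPrime)
    (hPi : IsInvertibleIdeal P) (h : P < A) : A = ⊤ :=
  hPi.eq_top_of_mul_eq (hA.mul_eq_of_isPrime hP h)

/-- Invertibility is preserved by extension to a larger domain. -/
theorem map {R : Type*} [CommRing R] [IsDomain R] [Algebra D R] [FaithfulSMul D R]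
    (hA : IsInvertibleIdeal A) : IsInvertibleIdeal (A.map (algebraMap D R)) := by
  obtain ⟨B, c, hc, hB⟩ := isInvertibleIdeal_iff.1 hA
  refine isInvertibleIdeal_iff.2 ⟨B.map (algebraMap D R), algebraMap D R c, ?_, ?_⟩
  · simpa using hc
  · rw [← Ideal.map_mul, hB, Ideal.map_span, Set.image_singleton]

end IsInvertibleIdeal

theorem IsMNI.ne_bot {P : Ideal D} (h : IsMNI P) : P ≠ ⊥ := h.1.1

theorem IsMNI.not_isInvertibleIdeal {P : Ideal D} (h : IsMNI P) : ¬ IsInvertibleIdeal P := h.1.2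

theorem IsMNI.isInvertibleIdeal_of_lt {P A : Ideal D} (h : IsMNI P) (hA : P < A) :
    IsInvertibleIdeal A := by
  by_contra h'
  exact hA.not_ge (h.2 ⟨fun h0 => by simp [h0] at hA, h'⟩ hA.le)

theorem IsMNI.eq_of_le {P A : Ideal D} (h : IsMNI P) (hA : ¬ IsInvertibleIdeal A) (hPA : P ≤ A) :
    A = P := by
  by_contra h'
  exact hA (h.isInvertibleIdeal_of_lt (lt_of_le_of_ne hPA (Ne.symm h')))

/-- If `ab ∈ P` with `a, b ∉ P`, then `P = (P + (a)) (P : a)` is a product of two ideals that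
properly contain `P`. -/
theorem IsMNI.isPrime {P : Ideal D} (h : IsMNI P) : P.IsPrime := by
  refine ⟨?_, fun {a b} hab => ?_⟩
  · rintro rfl
    exact h.not_isInvertibleIdeal isInvertibleIdeal_top
  by_contra! hc
  obtain ⟨ha, hb⟩ := hc
  have hA : IsInvertibleIdeal (P ⊔ Ideal.span {a}) := by
    refine h.isInvertibleIdeal_of_lt (lt_of_le_of_ne le_sup_left fun h => ha ?_)
    rw [h]
    exact Ideal.mem_sup_right (Ideal.mem_span_singleton_self a)
  obtain ⟨Y, hY⟩ := hA.exists_eq_mul_of_le (X := P) le_sup_left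
  have hPY : P < Y := by
    refine lt_of_le_of_ne (hY.le.trans Ideal.mul_le_right) fun h => hb ?_
    have h1 : (P ⊔ Ideal.span {a}) * (P ⊔ Ideal.span {b}) ≤ P := by
      rw [Ideal.sup_mul, Ideal.mul_sup (I := Ideal.span {a}),
        Ideal.span_singleton_mul_span_singleton]
      refine sup_le Ideal.mul_le_left (sup_le Ideal.mul_le_right ?_)
      rwa [Ideal.span_singleton_le_iff_mem]
    rw [h]
    exact hA.mul_le_mul_left_iff.1 (h1.trans hY.le)
      (Ideal.mem_sup_right (Ideal.mem_span_singleton_self b))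
  apply h.not_isInvertibleIdeal
  rw [hY]
  exact isInvertibleIdeal_mul_iff.2 ⟨hA, h.isInvertibleIdeal_of_lt hPY⟩

end Invertible

/-! ### Contractions from localizations and the factorization property -/

section Contraction

variable {D : Type*} [CommRing D]

/-- The contraction `I D_M ∩ D` of the extension of `I` to the localization at the prime `M`. -/
def localContraction (M : Ideal D) [M.IsPrime] (I : Ideal D) : Ideal D :=
  (I.map (algebraMap D (Localization.AtPrime M))).comap (algebraMap D (Localization.AtPrime M))

variable {M : Ideal D} [M.IsPrime] {I : Ideal D}

theorem mem_localContraction {x : D} : x ∈ localContraction M I ↔ ∃ s ∉ M, s * x ∈ I := by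
  rw [localContraction, Ideal.mem_comap,
    IsLocalization.algebraMap_mem_map_algebraMap_iff M.primeCompl]
  rfl

theorem le_localContraction : I ≤ localContraction M I := Ideal.le_comap_map

theorem mem_localContraction_of_mul_mem {s x : D} (hs : s ∉ M) (h : s * x ∈ localContraction M I) :
    x ∈ localContraction M I := by
  obtain ⟨t, ht, h'⟩ := mem_localContraction.1 h
  exact mem_localContraction.2
    ⟨t * s, fun hts => (Ideal.IsPrime.mem_or_mem ‹_› hts).elim ht hs, by rwa [mul_assoc]⟩

theorem localContraction_le_of_isPrime {P : Ideal D} (hP : P.IsPrime) (hIP : I ≤ P)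
    (hPM : P ≤ M) : localContraction M I ≤ P := fun x hx => by
  obtain ⟨s, hs, h⟩ := mem_localContraction.1 hx
  exact (hP.mem_or_mem (hIP h)).resolve_left fun h' => hs (hPM h')

/-- Nakayama's lemma for the principal ideal that `x` generates in `D_M`. -/
theorem notMem_mul_localContraction_span [IsDomain D] {x : D} (hx : x ≠ 0) :
    x ∉ M * localContraction M (Ideal.span {x}) := by
  intro h
  obtain ⟨s, hs, m, hm, h⟩ : ∃ s ∉ M, ∃ m ∈ M, s * x = m * x := by
    refine Submodule.mul_induction_on (C := fun d => ∃ s ∉ M, ∃ m ∈ M, s * d = m * x) h ?_ ?_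
    · intro m hm d hd
      obtain ⟨s, hs, hsd⟩ := mem_localContraction.1 hd
      obtain ⟨r, hr⟩ := Ideal.mem_span_singleton'.1 hsd
      exact ⟨s, hs, m * r, M.mul_mem_right r hm, by linear_combination -m * hr⟩
    · rintro a b ⟨s, hs, m, hm, h1⟩ ⟨t, ht, n, hn, h2⟩
      exact ⟨s * t, fun hts => (Ideal.IsPrime.mem_or_mem ‹_› hts).elim hs ht, t * m + s * n,
        M.add_mem (M.mul_mem_left t hm) (M.mul_mem_left s hn),
        by linear_combination t * h1 + s * h2⟩
  exact hs (mul_right_cancel₀ hx h ▸ hm)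

/-- Factors that are not contained in `M` can be dropped from a factorization of a contraction
from `D_M`. -/
theorem eq_mul_prod_filter_of_saturated {A J : Ideal D} {s : Finset (Ideal D)}
    [DecidablePred fun P : Ideal D => P ≤ M]
    (hA : ∀ t ∉ M, ∀ x, t * x ∈ A → x ∈ A) (h : A = J * ∏ P ∈ s, P) :
    A = J * ∏ P ∈ s with P ≤ M, P := by
  rw [← Finset.prod_filter_mul_prod_filter_not s (fun P : Ideal D => P ≤ M), ← mul_assoc] at h
  refine le_antisymm (h.le.trans Ideal.mul_le_left) fun x hx => ?_
  have hnot : ¬ (∏ P ∈ s with ¬ P ≤ M, P) ≤ M := fun hle => by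
    obtain ⟨P, hP, hPM⟩ := (Ideal.IsPrime.prod_le ‹_›).1 hle
    exact (Finset.mem_filter.1 hP).2 hPM
  obtain ⟨t, ht, htM⟩ := SetLike.not_le_iff_exists.1 hnot
  refine hA t htM x ?_
  rw [h, mul_comm t]
  exact Ideal.mul_mem_mul hx ht

end Contraction

/-- Every nonzero non-invertible ideal is the product of an invertible ideal and of finitely many
distinct MNI ideals. -/
def HasMNIFactorization (D : Type*) [CommRing D] [IsDomain D] : Prop :=
  ∀ I : Ideal D, I ≠ ⊥ → ¬ IsInvertibleIdeal I →
    ∃ (J : Ideal D) (s : Finset (Ideal D)),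
      IsInvertibleIdeal J ∧ (∀ P ∈ s, IsMNI P) ∧ I = J * ∏ P ∈ s, P

theorem hasMNIFactorization_iff {D : Type*} [CommRing D] [IsDomain D] :
    HasMNIFactorization D ↔ ∀ I : Ideal D, I ≠ ⊥ → ¬ IsInvertibleIdeal I →
        ∃ (J : Ideal D) (k : ℕ) (P : Fin k → Ideal D),
          IsInvertibleIdeal J ∧ Function.Injective P ∧ (∀ i, IsMNI (P i)) ∧
            I = J * ∏ i, P i := by
  classical
  refine forall₃_congr fun I _ _ => exists_congr fun J => ⟨?_, ?_⟩
  · rintro ⟨s, hJ, hs, h⟩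
    refine ⟨s.card, fun i => s.equivFin.symm i, hJ,
      Subtype.val_injective.comp s.equivFin.symm.injective, fun i => hs _ (Subtype.mem _), ?_⟩
    rw [h, ← Finset.prod_coe_sort s, s.equivFin.symm.prod_comp (fun P : s => (P : Ideal D))]
  · rintro ⟨k, P, hJ, hP, hs, h⟩
    refine ⟨Finset.univ.image P, hJ, by simpa using hs, ?_⟩
    rw [h, Finset.prod_image hP.injOn]

namespace HasMNIFactorization

variable {D : Type*} [CommRing D] [IsDomain D] (h : HasMNIFactorization D)
include h

/-- In `P = J P₁ ⋯ Pₖ` the prime ideal `P` contains `J` or some `Pᵢ`. -/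
theorem isMNI_of_isPrime {P : Ideal D} (hP : P.IsPrime) (h0 : P ≠ ⊥)
    (hPi : ¬ IsInvertibleIdeal P) : IsMNI P := by
  obtain ⟨J, s, hJ, hs, hPs⟩ := h P h0 hPi
  rcases hP.mul_le.1 hPs.ge with hle | hle
  · refine absurd ?_ hPi
    rwa [le_antisymm (hPs.le.trans Ideal.mul_le_left) hle]
  · obtain ⟨Q, hQ, hQP⟩ := hP.prod_le.1 hle
    rw [(hs Q hQ).eq_of_le hPi hQP]
    exact hs Q hQ

/-- If an invertible prime ideal `P` were properly contained in a maximal ideal `M`, then, for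
`a ∈ M \ P`, the ideal `P + (a²)` would be a product of distinct maximal ideals, so it would be a
radical ideal and contain `a`. -/
theorem isMaximal_of_isInvertibleIdeal {P : Ideal D} (hP : P.IsPrime)
    (hPi : IsInvertibleIdeal P) : P.IsMaximal := by
  obtain ⟨M, hM, hPM⟩ := P.exists_le_maximal hP.ne_top
  rcases hPM.eq_or_lt with rfl | hPM
  · exact hM
  exfalso
  obtain ⟨a, haM, haP⟩ := SetLike.exists_of_lt hPM
  set A := P ⊔ Ideal.span {a ^ 2} with hA
  have haA : a ^ 2 ∈ A := Ideal.mem_sup_right (Ideal.mem_span_singleton_self _)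
  have hPA : P < A := by
    refine lt_of_le_of_ne le_sup_left fun h => haP (hP.mem_of_pow_mem 2 ?_)
    rwa [h]
  have hAM : A ≤ M := sup_le hPM.le
    ((Ideal.span_singleton_le_iff_mem M).2 (Ideal.pow_mem_of_mem M haM 2 two_pos))
  have hAi : ¬ IsInvertibleIdeal A := fun hAi =>
    hM.ne_top (top_le_iff.1 (hAi.eq_top_of_isPrime_lt hP hPi hPA ▸ hAM))
  obtain ⟨J, s, hJ, hs, hAs⟩ := h A (hPA.ne_bot) hAi
  have hJ1 : J = ⊤ := hJ.eq_top_of_isPrime_lt hP hPi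
    (hPA.trans_le (hAs.le.trans Ideal.mul_le_left))
  rw [hJ1, Ideal.top_mul] at hAs
  have hAle : ∀ Q ∈ s, A ≤ Q := fun Q hQ =>
    hAs.le.trans (Ideal.prod_le_inf.trans (Finset.inf_le hQ))
  have hmax : ∀ Q ∈ s, Q.IsMaximal := fun Q hQ => by
    obtain ⟨N, hN, hQN⟩ := Q.exists_le_maximal (hs Q hQ).isPrime.ne_top
    have hPN : P < N := hPA.trans_le ((hAle Q hQ).trans hQN)
    rw [← (hs Q hQ).eq_of_le (fun hNi => hN.ne_top (hNi.eq_top_of_isPrime_lt hP hPi hPN)) hQN]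
    exact hN
  have haA' : a ∈ A := by
    rw [hAs, Ideal.prod_eq_iInf_of_pairwise_isCoprime (J := fun Q => Q)
      fun Q hQ Q' hQ' hne => ?_]
    · simp only [Ideal.mem_iInf]
      exact fun Q hQ => (hmax Q hQ).isPrime.mem_of_pow_mem 2 (hAle Q hQ haA)
    · have := hmax Q hQ
      have := hmax Q' hQ'
      exact Ideal.isCoprime_of_isMaximal hne
  obtain ⟨p, hp, q, hq, hpq⟩ := Submodule.mem_sup.1 haA'
  obtain ⟨r, rfl⟩ := Ideal.mem_span_singleton'.1 hq
  have h1 : a * (1 - r * a) ∈ P := by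
    convert hp using 1
    linear_combination -hpq
  have h2 := hPM.le ((hP.mem_or_mem h1).resolve_left haP)
  exact hM.ne_top ((Ideal.eq_top_iff_one M).2
    (by simpa using M.add_mem h2 (M.mul_mem_left r haM)))

/-- The ideals `I = x D_M ∩ D` are invertible. In a factorization of a non-invertible `I` only MNI
ideals `P ⊆ M` matter. If `M` is invertible, then `P = MP`, so that `I = MI`, against Nakayama's lemma
in `D_M`. Otherwise `M` is an MNI ideal and `I = JM`. Then `M : M = D`, because `M : M ⊆ I : I ⊆ D_M`,
and the factorization `M² = J'M` forces `M ⊆ J'`. Both `J' = M` and `J' = D` are absurd. -/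
theorem isInvertibleIdeal_localContraction {M : Ideal D} [hM : M.IsMaximal] {x : D} (hx : x ≠ 0)
    (hxM : x ∈ M) : IsInvertibleIdeal (localContraction M (Ideal.span {x})) := by
  classical
  by_contra hI
  set I := localContraction M (Ideal.span {x}) with hIdef
  have hxI : x ∈ I := le_localContraction (Ideal.mem_span_singleton_self x)
  have hI0 : I ≠ ⊥ := fun h0 => hx (by simpa [h0] using hxI)
  obtain ⟨J, s, hJ, hs, hIs⟩ := h I hI0 hI
  replace hIs : I = _ := eq_mul_prod_filter_of_saturated (M := M)
    (fun t ht y hy => mem_localContraction_of_mul_mem ht hy) hIs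
  obtain ⟨P, hP⟩ : (s.filter (· ≤ M)).Nonempty := by
    rw [Finset.nonempty_iff_ne_empty]
    intro h0
    rw [h0, Finset.prod_empty, mul_one] at hIs
    exact hI (hIs ▸ hJ)
  obtain ⟨hPs, hPM⟩ := Finset.mem_filter.1 hP
  have hP' := hs P hPs
  by_cases hMi : IsInvertibleIdeal M
  · -- `P = M P`, so `I = M I`
    have hlt : P < M := lt_of_le_of_ne hPM fun h => hP'.not_isInvertibleIdeal (h ▸ hMi)
    have hMI : M * I = I := by
      rw [hIs, ← Finset.mul_prod_erase _ _ hP, mul_left_comm J, ← mul_assoc M,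
        hMi.mul_eq_of_isPrime hP'.isPrime hlt]
    exact notMem_mul_localContraction_span hx (hMI.symm ▸ hxI : x ∈ M * I)
  have hM0 : M ≠ ⊥ := fun h0 => hx (by simpa [h0] using hxM)
  have hMMNI : IsMNI M := h.isMNI_of_isPrime hM.isPrime hM0 hMi
  have hIJ : I = J * M := by
    have : s.filter (· ≤ M) = {M} := by
      refine Finset.eq_singleton_iff_nonempty_unique_mem.2 ⟨⟨P, hP⟩, fun Q hQ => ?_⟩
      obtain ⟨hQs, hQM⟩ := Finset.mem_filter.1 hQ
      exact ((hs Q hQs).eq_of_le hMi hQM).symm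
    rw [hIs, this, Finset.prod_singleton]
  -- the elementwise form of `M : M = D`
  have hcolon : ∀ e c : D, c ≠ 0 → (∀ m ∈ M, e * m ∈ Ideal.span {c} * M) → e ∈ Ideal.span {c} := by
    intro e c hc he
    have hMe : M ≤ (Ideal.span {c}).colon {e} := fun m hm => by
      rw [Submodule.mem_colon_singleton, smul_eq_mul, mul_comm]
      exact Ideal.mul_le_left (he m hm)
    have hIe : Ideal.span {e} * I ≤ Ideal.span {c} * I := by
      rw [hIJ, mul_left_comm, mul_left_comm (Ideal.span {c})]
      exact Ideal.mul_mono_right (Ideal.span_singleton_mul_le_iff.2 he)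
    obtain ⟨d, hd, hde⟩ := Ideal.mem_span_singleton_mul.1
      (hIe (Ideal.mul_mem_mul (Ideal.mem_span_singleton_self e) hxI))
    obtain ⟨t, ht, htd⟩ := mem_localContraction.1 hd
    obtain ⟨r, hr⟩ := Ideal.mem_span_singleton'.1 htd
    have hte : t ∈ (Ideal.span {c}).colon {e} := by
      rw [Submodule.mem_colon_singleton, smul_eq_mul]
      refine Ideal.mem_span_singleton'.2 ⟨r, mul_right_cancel₀ hx ?_⟩
      linear_combination c * hr + t * hde
    have htop : (Ideal.span {c}).colon {e} = ⊤ := by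
      by_contra hne
      exact ht (hM.eq_of_le hne hMe ▸ hte)
    have h1 := (Ideal.eq_top_iff_one _).1 htop
    rwa [Submodule.mem_colon_singleton, smul_eq_mul, one_mul] at h1
  have hMM : ¬ IsInvertibleIdeal (M * M) := fun h' => hMi (isInvertibleIdeal_mul_iff.1 h').1
  obtain ⟨J', s', hJ', hs', hMs⟩ := h (M * M) (by simpa using hM0) hMM
  have hMJ : M * M = J' * M := by
    have hle : ∀ Q ∈ s', Q = M := fun Q hQ => by
      have h1 : M * M ≤ Q :=
        hMs.le.trans (Ideal.mul_le_right.trans (Ideal.prod_le_inf.trans (Finset.inf_le hQ)))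
      have h2 : M ≤ Q := ((hs' Q hQ).isPrime.mul_le.1 h1).elim id id
      exact (hM.eq_of_le (hs' Q hQ).isPrime.ne_top h2).symm
    have : s' = {M} := by
      refine Finset.eq_singleton_iff_nonempty_unique_mem.2 ⟨?_, hle⟩
      rw [Finset.nonempty_iff_ne_empty]
      rintro rfl
      exact hMM (by rwa [hMs, Finset.prod_empty, mul_one])
    rw [hMs, this, Finset.prod_singleton]
  have hMJ' : M ≤ J' := by
    obtain ⟨B, c, hc, hB⟩ := isInvertibleIdeal_iff.1 hJ'
    have hMB : M * B ≤ Ideal.span {c} := fun e he => by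
      refine hcolon e c hc fun m hm => ?_
      have : M * B * M = Ideal.span {c} * M := by
        rw [← hB, mul_right_comm, hMJ, mul_right_comm]
      exact this ▸ Ideal.mul_mem_mul he hm
    rw [← hB, mul_comm J'] at hMB
    have hBi : IsInvertibleIdeal B := IsInvertibleIdeal.of_mul_eq_span hc (by rw [mul_comm, hB])
    exact hBi.mul_le_mul_left_iff.1 (by rwa [mul_comm B M])
  by_cases hJtop : J' = ⊤
  · rw [hJtop, Ideal.top_mul] at hMJ
    refine notMem_mul_localContraction_span hx (M := M) ?_
    rw [← hIdef, hIJ, mul_left_comm, hMJ, ← hIJ]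
    exact hxI
  · exact hMi (hM.eq_of_le hJtop hMJ' ▸ hJ')

end HasMNIFactorization

/-! ### Factorization implies h-locality -/

/-- If every nonzero prime ideal lies in a unique maximal ideal, then `D_M D_N` is the fraction
field of `D` for all distinct maximal ideals `M` and `N`. -/
theorem exists_mul_mem_of_existsUnique_isMaximal {D : Type*} [CommRing D]
    (hu : ∀ P : Ideal D, P.IsPrime → P ≠ ⊥ → ∃! M : Ideal D, M.IsMaximal ∧ P ≤ M)
    {M N : Ideal D} [hM : M.IsMaximal] [hN : N.IsMaximal] (hMN : M ≠ N) {I : Ideal D}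
    (hI : I ≠ ⊥) : ∃ s ∉ M, ∃ t ∉ N, s * t ∈ I := by
  by_contra! hc
  obtain ⟨P, hP, hIP, hdis⟩ := I.exists_le_prime_disjoint (M.primeCompl ⊔ N.primeCompl) <| by
    rw [Set.disjoint_left]
    rintro x hx hxs
    obtain ⟨s, hs, t, ht, rfl⟩ := Submonoid.mem_sup.1 hxs
    exact hc s hs t ht hx
  have hle : ∀ N' : Ideal D, ∀ [N'.IsPrime], N'.primeCompl ≤ M.primeCompl ⊔ N.primeCompl →
      P ≤ N' := fun N' _ hN' x hx => by
    by_contra hxN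
    exact Set.disjoint_left.1 hdis hx (hN' hxN)
  exact hMN ((hu P hP (ne_bot_of_le_ne_bot hI hIP)).unique ⟨hM, hle M le_sup_left⟩
    ⟨hN, hle N le_sup_right⟩)

theorem localContraction_not_le {D : Type*} [CommRing D]
    (hu : ∀ P : Ideal D, P.IsPrime → P ≠ ⊥ → ∃! M : Ideal D, M.IsMaximal ∧ P ≤ M)
    {M N : Ideal D} [hM : M.IsMaximal] [hN : N.IsMaximal] (hMN : M ≠ N) {I : Ideal D}
    (hI : I ≠ ⊥) : ¬ localContraction M I ≤ N := fun hle => by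
  obtain ⟨s, hs, t, ht, hst⟩ := exists_mul_mem_of_existsUnique_isMaximal hu hMN hI
  exact ht (hle (mem_localContraction.2 ⟨s, hs, hst⟩))

/-- A maximal ideal contains at most one MNI ideal. If `M` is invertible and contains the MNI
ideals `P ≠ Q`, then `M (P + Q) = P + Q` and `P + Q` is invertible. -/
theorem IsMNI.eq_of_le_isMaximal {D : Type*} [CommRing D] [IsDomain D] {M P Q : Ideal D}
    (hM : M.IsMaximal) (hP : IsMNI P)
    (hQ : IsMNI Q) (hPM : P ≤ M) (hQM : Q ≤ M) : P = Q := by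
  by_cases hMi : IsInvertibleIdeal M
  · by_contra hne
    have hlt : ∀ {P : Ideal D}, IsMNI P → P ≤ M → M * P = P := fun hP hPM =>
      hMi.mul_eq_of_isPrime hP.isPrime
        (lt_of_le_of_ne hPM fun h => hP.not_isInvertibleIdeal (h ▸ hMi))
    have hi : IsInvertibleIdeal (P ⊔ Q) := by
      by_contra hi
      exact hne ((hP.eq_of_le hi le_sup_left).symm.trans (hQ.eq_of_le hi le_sup_right))
    exact hM.ne_top (hi.eq_top_of_mul_eq (by rw [Ideal.mul_sup, hlt hP hPM, hlt hQ hQM]))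
  · exact (hP.eq_of_le hMi hPM).symm.trans (hQ.eq_of_le hMi hQM)

namespace HasMNIFactorization

variable {D : Type*} [CommRing D] [IsDomain D] (h : HasMNIFactorization D)
include h

/-- If a nonzero prime `P` lay in two maximal ideals `M` and `N`, then `N` would be invertible and
`x D_M ∩ D`, for `0 ≠ x ∈ P`, would be an invertible ideal unchanged by multiplication with `N`. -/
theorem existsUnique_isMaximal {P : Ideal D} (hP : P.IsPrime) (h0 : P ≠ ⊥) :
    ∃! M : Ideal D, M.IsMaximal ∧ P ≤ M := by
  obtain ⟨M, hM, hPM⟩ := P.exists_le_maximal hP.ne_top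
  refine ⟨M, ⟨hM, hPM⟩, ?_⟩
  rintro N ⟨hN, hPN⟩
  by_contra hne
  have hPmax : ¬ P.IsMaximal := fun hmax =>
    hne ((hmax.eq_of_le hN.ne_top hPN).symm.trans (hmax.eq_of_le hM.ne_top hPM))
  have hPN' : P < N := lt_of_le_of_ne hPN fun h => hPmax (h ▸ hN)
  have hNi : IsInvertibleIdeal N := (h.isMNI_of_isPrime hP h0
    fun hi => hPmax (h.isMaximal_of_isInvertibleIdeal hP hi)).isInvertibleIdeal_of_lt hPN'
  obtain ⟨x, hxP, hx0⟩ := Submodule.exists_mem_ne_zero_of_ne_bot h0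
  set I := localContraction M (Ideal.span {x}) with hI
  have hIi : IsInvertibleIdeal I := h.isInvertibleIdeal_localContraction hx0 (hPM hxP)
  have hIP : I ≤ P :=
    localContraction_le_of_isPrime hP ((Ideal.span_singleton_le_iff_mem P).2 hxP) hPM
  -- `N⁻¹ I = I` because `I` is a contraction from `D_M` and `N` is not contained in `M`
  obtain ⟨Y, hY⟩ := hNi.exists_eq_mul_of_le (hIP.trans hPN)
  obtain ⟨t, htN, htM⟩ := SetLike.not_le_iff_exists.1
    fun hle : N ≤ M => hne (hN.eq_of_le hM.ne_top hle)
  have hYI : Y ≤ I := fun y hy => by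
    refine mem_localContraction_of_mul_mem htM ?_
    rw [← hI, hY]
    exact Ideal.mul_mem_mul htN hy
  have hNI : N * I = I := le_antisymm Ideal.mul_le_right
    (hY.le.trans (Ideal.mul_mono_right hYI))
  exact hN.ne_top (hIi.eq_top_of_mul_eq hNI)

/-- The ideals `x (x D_M ∩ D)⁻¹`, for `M` maximal with `x ∈ M`, generate together with `x` the unit
ideal, so finitely many of them do; but each of them lies in all maximal ideals `N ≠ M` containing
`x`. -/
theorem finite_isMaximal {I : Ideal D} (hI : I ≠ ⊥) :
    {M : Ideal D | M.IsMaximal ∧ I ≤ M}.Finite := by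
  obtain ⟨x, hxI, hx0⟩ := Submodule.exists_mem_ne_zero_of_ne_bot hI
  let S := {M : Ideal D | M.IsMaximal ∧ x ∈ M}
  -- `b` is an element of `x (x D_M ∩ D)⁻¹` outside `M`
  have key : ∀ M : Ideal D, ∃ b : D, M ∈ S → b ∉ M ∧ ∀ N ∈ S, b ∉ N → M = N := by
    intro M
    by_cases hMS : M ∈ S
    swap
    · exact ⟨0, fun h => absurd h hMS⟩
    have hM := hMS.1
    have hxM := hMS.2
    obtain ⟨B, hB⟩ := (h.isInvertibleIdeal_localContraction hx0 hxM).exists_eq_mul_of_le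
      (le_localContraction (M := M) (I := Ideal.span {x}))
    have hBM : ¬ B ≤ M := fun hle => by
      refine notMem_mul_localContraction_span (M := M) hx0 ?_
      rw [mul_comm]
      exact Ideal.mul_mono_right hle (hB ▸ Ideal.mem_span_singleton_self x)
    obtain ⟨b, hbB, hbM⟩ := SetLike.not_le_iff_exists.1 hBM
    refine ⟨b, fun _ => ⟨hbM, fun N hN hbN => ?_⟩⟩
    by_contra hMN
    have := hN.1
    refine localContraction_not_le (fun P hP h0 => h.existsUnique_isMaximal hP h0) hMN
      (I := Ideal.span {x}) (by simpa using hx0) fun d hd => ?_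
    have : d * b ∈ N := (Ideal.span_singleton_le_iff_mem N).2 hN.2
      (hB ▸ Ideal.mul_mem_mul hd hbB)
    exact (hN.1.isPrime.mem_or_mem this).resolve_right hbN
  choose b hb using key
  have htop : Ideal.span (insert x (b '' S)) = ⊤ := by
    by_contra hne
    obtain ⟨N, hN, hle⟩ := Ideal.exists_le_maximal _ hne
    have hNS : N ∈ S := ⟨hN, hle (Ideal.subset_span (Set.mem_insert _ _))⟩
    exact ((hb N hNS).1 (hle (Ideal.subset_span (Set.mem_insert_of_mem _ ⟨N, hNS, rfl⟩))))
  obtain ⟨T, hTsub, hT⟩ := Submodule.mem_span_finite_of_mem_span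
    ((Ideal.eq_top_iff_one _).1 htop)
  refine (Set.Finite.of_injOn (t := (T : Set D)) (f := b) ?_ ?_ T.finite_toSet).subset
    (show _ ⊆ S from fun M hM => ⟨hM.1, hM.2 hxI⟩)
  · intro N hN
    obtain ⟨g, hgT, hgN⟩ : ∃ g ∈ T, g ∉ N := by
      by_contra! hc
      exact hN.1.ne_top ((Ideal.eq_top_iff_one N).2 ((Ideal.span_le (I := N)).2 hc hT))
    rcases hTsub hgT with rfl | ⟨M, hM, rfl⟩
    · exact absurd hN.2 hgN
    · rwa [(hb M hM).2 N hN hgN] at hgT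
  · intro M hM N hN hMN
    exact (hb M hM).2 N hN (hMN ▸ (hb N hN).1)

theorem isHLocal : IsHLocal D :=
  ⟨fun _ hI => h.finite_isMaximal hI, fun _ hP h0 => h.existsUnique_isMaximal hP h0⟩

/-- In the localization at a maximal ideal, all non-principal ideals are multiples of one
prime ideal, generated by the unique MNI ideal that the maximal ideal contains. -/
theorem isPrincipalIdealRing_localization_or (M : Ideal D) [hM : M.IsMaximal] :
    IsPrincipalIdealRing (Localization.AtPrime M) ∨
      ∃ Q : Ideal (Localization.AtPrime M), Q.IsPrime ∧ ∀ I : Ideal (Localization.AtPrime M),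
        (∃ a, I = Ideal.span {a}) ∨ ∃ y, I = Ideal.span {y} * Q := by
  classical
  have hinv : ∀ A : Ideal D, IsInvertibleIdeal A →
      ∃ a, A.map (algebraMap D (Localization.AtPrime M)) = Ideal.span {a} := fun A hA =>
    (hA.map (R := Localization.AtPrime M)).exists_eq_span.imp fun a ha => ha.2
  have key : ∀ I : Ideal (Localization.AtPrime M), (∃ a, I = Ideal.span {a}) ∨
      ∃ y, ∃ P : Ideal D, IsMNI P ∧ P ≤ M ∧
        I = Ideal.span {y} * P.map (algebraMap D (Localization.AtPrime M)) := by
    intro I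
    set A := I.comap (algebraMap D (Localization.AtPrime M)) with hA
    have hAI : A.map (algebraMap D (Localization.AtPrime M)) = I :=
      IsLocalization.map_under M.primeCompl _ I
    by_cases hI : ∃ a, I = Ideal.span {a}
    · exact Or.inl hI
    have hA0 : A ≠ ⊥ := by
      intro h0
      rw [h0, Ideal.map_bot] at hAI
      exact hI ⟨0, by simp [← hAI]⟩
    have hAi : ¬ IsInvertibleIdeal A := fun hAi => hI (hAI ▸ hinv A hAi)
    obtain ⟨J, s, hJ, hs, hAs⟩ := h A hA0 hAi
    have hsat : ∀ t ∉ M, ∀ x, t * x ∈ A → x ∈ A := fun t ht x hx => by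
      have : localContraction M A = A := by rw [localContraction, hAI]
      rw [← this] at hx ⊢
      exact mem_localContraction_of_mul_mem ht hx
    replace hAs : A = _ := eq_mul_prod_filter_of_saturated hsat hAs
    obtain ⟨P, hP⟩ : (s.filter (· ≤ M)).Nonempty := by
      rw [Finset.nonempty_iff_ne_empty]
      intro h0
      rw [h0, Finset.prod_empty, mul_one] at hAs
      exact hAi (hAs ▸ hJ)
    obtain ⟨hPs, hPM⟩ := Finset.mem_filter.1 hP
    have hfil : s.filter (· ≤ M) = {P} := by
      refine Finset.eq_singleton_iff_unique_mem.2 ⟨hP, fun Q hQ => ?_⟩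
      obtain ⟨hQs, hQM⟩ := Finset.mem_filter.1 hQ
      exact (hs Q hQs).eq_of_le_isMaximal hM (hs P hPs) hQM hPM
    obtain ⟨y, hy⟩ := hinv J hJ
    refine Or.inr ⟨y, P, hs P hPs, hPM, ?_⟩
    rw [← hAI, hAs, hfil, Finset.prod_singleton, Ideal.map_mul, hy]
  by_cases hex : ∃ P : Ideal D, IsMNI P ∧ P ≤ M
  · obtain ⟨P, hP, hPM⟩ := hex
    refine Or.inr ⟨P.map (algebraMap D (Localization.AtPrime M)), ?_, fun I => ?_⟩
    · exact IsLocalization.isPrime_of_isPrime_disjoint M.primeCompl _ P hP.isPrime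
        (Set.disjoint_left.2 fun x hx hxP => hx (hPM hxP))
    · refine (key I).imp_right ?_
      rintro ⟨y, Q, hQ, hQM, hI⟩
      exact ⟨y, by rw [hI, hQ.eq_of_le_isMaximal hM hP hQM hPM]⟩
  · refine Or.inl ⟨fun I => ?_⟩
    rcases key I with ⟨a, ha⟩ | ⟨y, P, hP, hPM, -⟩
    · exact ⟨a, ha⟩
    · exact absurd ⟨P, hP, hPM⟩ hex

end HasMNIFactorization

/-! ### Value groups and divisibility -/

/-- The map `u` is additive on `R \ {0}`, where it turns divisibility into the order of `Γ`. For a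
domain `R` it is then, up to units, an additive valuation with valuation ring `R`. The value of `u`
at `0` is irrelevant. -/
structure IsDivisibilityMap {R Γ : Type*} [CommRing R] [AddCommGroup Γ] [LinearOrder Γ]
    (u : R → Γ) : Prop where
  map_mul : ∀ a b, a ≠ 0 → b ≠ 0 → u (a * b) = u a + u b
  dvd_iff : ∀ a b, a ≠ 0 → b ≠ 0 → (a ∣ b ↔ u a ≤ u b)

/-- A divisibility map that takes all nonnegative values; then `Γ` is the value group. -/
structure IsValueMap {R Γ : Type*} [CommRing R] [AddCommGroup Γ] [LinearOrder Γ]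
    (u : R → Γ) : Prop extends IsDivisibilityMap u where
  surj : ∀ g, 0 ≤ g → ∃ a, a ≠ 0 ∧ u a = g

section ValueGroup

variable {R : Type*} [CommRing R] [IsDomain R] {Γ : Type*} [AddCommGroup Γ] [LinearOrder Γ]

namespace IsDivisibilityMap

variable {u : R → Γ} (hu : IsDivisibilityMap u)
include hu

theorem valuationRing : ValuationRing R := by
  refine ValuationRing.iff_dvd_total.2 ⟨fun a b => ?_⟩
  by_cases ha : a = 0
  · exact Or.inr (ha ▸ dvd_zero b)
  by_cases hb : b = 0
  · exact Or.inl (hb ▸ dvd_zero a)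
  rw [hu.dvd_iff a b ha hb, hu.dvd_iff b a hb ha]
  exact le_total _ _

theorem le_map_add {a b : R} (ha : a ≠ 0) (hb : b ≠ 0) (hab : a + b ≠ 0) :
    u a ≤ u (a + b) ∨ u b ≤ u (a + b) := by
  have := hu.valuationRing
  rcases ValuationRing.dvd_total a b with h | h
  · exact Or.inl ((hu.dvd_iff _ _ ha hab).1 (dvd_add dvd_rfl h))
  · exact Or.inr ((hu.dvd_iff _ _ hb hab).1 (dvd_add h dvd_rfl))

variable [IsOrderedAddMonoid Γ]

theorem map_one : u 1 = 0 := by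
  have := hu.map_mul 1 1 one_ne_zero one_ne_zero
  rwa [mul_one, left_eq_add] at this

theorem nonneg {a : R} (ha : a ≠ 0) : 0 ≤ u a := by
  rw [← hu.map_one, ← hu.dvd_iff 1 a one_ne_zero ha]
  exact one_dvd a

theorem map_pow {a : R} (ha : a ≠ 0) (n : ℕ) : u (a ^ n) = n • u a := by
  induction n with
  | zero => rw [pow_zero, zero_nsmul, hu.map_one]
  | succ n ih => rw [pow_succ, hu.map_mul _ _ (pow_ne_zero n ha) ha, ih, succ_nsmul]

theorem isUnit_iff {a : R} (ha : a ≠ 0) : IsUnit a ↔ u a = 0 := by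
  rw [isUnit_iff_dvd_one, hu.dvd_iff a 1 ha one_ne_zero, hu.map_one]
  exact ⟨fun h => le_antisymm h (hu.nonneg ha), fun h => h.le⟩

/-- The multiplicatively written valuation on `R` attached to a divisibility map. -/
noncomputable def toValuation : Valuation R (WithZero (Multiplicative Γ)) := by
  classical
  exact {
    toFun := fun a => if a = 0 then 0 else WithZero.exp (-u a)
    map_zero' := if_pos rfl
    map_one' := by simp [hu.map_one]
    map_mul' := fun a b => by
      by_cases ha : a = 0
      · simp [ha]
      by_cases hb : b = 0
      · simp [hb]
      simp [ha, hb, hu.map_mul a b ha hb, WithZero.exp_add, add_comm]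
    map_add_le_max' := fun a b => by
      by_cases hab : a + b = 0
      · simp [hab]
      by_cases ha : a = 0
      · simp [ha]
      by_cases hb : b = 0
      · simp [hb]
      simp only [hab, ha, hb, if_false, le_max_iff, WithZero.exp_le_exp, neg_le_neg_iff]
      exact hu.le_map_add ha hb hab }

theorem toValuation_apply {a : R} (ha : a ≠ 0) : hu.toValuation a = WithZero.exp (-u a) :=
  if_neg ha

end IsDivisibilityMap

theorem IsValueMap.isValuationDomainWithValueGroup [IsOrderedAddMonoid Γ] {u : R → Γ}
    (hu : IsValueMap u) : IsValuationDomainWithValueGroup R Γ := by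
  have hV := hu.valuationRing
  refine ⟨hV, ?_⟩
  have hS : R⁰ ≤ hu.toValuation.supp.primeCompl := fun a ha h => by
    have : hu.toValuation a = 0 := h
    rw [hu.toValuation_apply (nonZeroDivisors.ne_zero ha)] at this
    exact WithZero.exp_ne_zero this
  set v := hu.toValuation.extendToLocalization hS (FractionRing R) with hv
  have hvR : ∀ a : R, a ≠ 0 → v (algebraMap R _ a) = WithZero.exp (-u a) := fun a ha => by
    rw [hv, Valuation.extendToLocalization_apply_map_apply, hu.toValuation_apply ha]
  have heq : (ValuationRing.valuation R (FractionRing R)).IsEquiv v := by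
    refine Valuation.isEquiv_of_val_le_one fun {x} => ?_
    rw [← Valuation.mem_integer_iff, ValuationRing.mem_integer_iff]
    by_cases hx : x = 0
    · simp only [hx, map_zero, zero_le, iff_true]
      exact ⟨0, map_zero _⟩
    obtain ⟨a, b, hb, rfl⟩ := IsFractionRing.div_surjective R x
    have hb0 := nonZeroDivisors.ne_zero hb
    have hb' : algebraMap R (FractionRing R) b ≠ 0 := by simpa using hb0
    have ha0 : a ≠ 0 := by rintro rfl; simp at hx
    rw [map_div₀, hvR a ha0, hvR b hb0, div_le_one₀ (zero_lt_iff.2 WithZero.exp_ne_zero),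
      WithZero.exp_le_exp, neg_le_neg_iff, ← hu.dvd_iff b a hb0 ha0]
    constructor
    · rintro ⟨c, hc⟩
      refine ⟨c, IsFractionRing.injective R (FractionRing R) ?_⟩
      rw [map_mul, hc, mul_div_cancel₀ _ hb']
    · rintro ⟨c, rfl⟩
      exact ⟨c, by rw [map_mul, mul_div_cancel_left₀ _ hb']⟩
  have hsurj : Function.Surjective (ValuationRing.valuation R (FractionRing R)) :=
    Quotient.mk''_surjective
  have hvs : Function.Surjective v := by
    intro g
    induction g with
    | zero => exact ⟨0, map_zero v⟩
    | coe g =>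
      obtain ⟨g, rfl⟩ := Multiplicative.ofAdd.surjective g
      rcases le_total 0 g with hg | hg
      · obtain ⟨a, ha, rfl⟩ := hu.surj g hg
        refine ⟨(algebraMap R _ a)⁻¹, ?_⟩
        rw [map_inv₀, hvR a ha, WithZero.exp_neg, inv_inv]
        rfl
      · obtain ⟨a, ha, hag⟩ := hu.surj (-g) (neg_nonneg.2 hg)
        refine ⟨algebraMap R _ a, ?_⟩
        rw [hvR a ha, hag, neg_neg]
        rfl
  set f : ValuationRing.ValueGroup R (FractionRing R) → WithZero (Multiplicative Γ) :=
    fun g => v (Function.surjInv hsurj g) with hf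
  have hfv : ∀ x, f (ValuationRing.valuation R (FractionRing R) x) = v x := fun x =>
    heq.eq_iff.1 (Function.surjInv_eq hsurj _)
  have hfle : ∀ g g', f g ≤ f g' ↔ g ≤ g' := fun g g' => by
    obtain ⟨x, rfl⟩ := hsurj g
    obtain ⟨y, rfl⟩ := hsurj g'
    rw [hfv, hfv]
    exact (heq x y).symm
  have hbij : Function.Bijective f := by
    refine ⟨fun g g' h => le_antisymm ((hfle _ _).1 h.le) ((hfle _ _).1 h.ge), fun g => ?_⟩
    obtain ⟨x, rfl⟩ := hvs g
    exact ⟨_, hfv x⟩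
  exact ⟨{ Equiv.ofBijective f hbij with
    map_mul' := fun g g' => by
      obtain ⟨x, rfl⟩ := hsurj g
      obtain ⟨y, rfl⟩ := hsurj g'
      simp only [Equiv.toFun_as_coe, Equiv.ofBijective_apply]
      rw [← map_mul, hfv, hfv, hfv, map_mul]
    map_le_map_iff' := fun {g g'} => hfle g g' }⟩

theorem IsValuationDomainWithValueGroup.exists_isValueMap [IsOrderedAddMonoid Γ]
    (h : IsValuationDomainWithValueGroup R Γ) : ∃ u : R → Γ, IsValueMap u := by
  obtain ⟨hV, ⟨e⟩⟩ := h
  set K := FractionRing R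
  have he0 : ∀ x : K, x ≠ 0 → e (ValuationRing.valuation R K x) ≠ 0 := fun x hx h0 => by
    rw [← map_zero e, (EquivLike.injective e).eq_iff, Valuation.zero_iff] at h0
    exact hx h0
  have hR0 : ∀ a : R, a ≠ 0 → algebraMap R K a ≠ 0 := fun a ha => by simpa using ha
  refine ⟨fun a => -WithZero.log (e (ValuationRing.valuation R K (algebraMap R K a))),
    ⟨fun a b ha hb => ?_, fun a b ha hb => ?_⟩, fun g hg => ?_⟩
  · rw [map_mul, map_mul, map_mul, WithZero.log_mul (he0 _ (hR0 a ha)) (he0 _ (hR0 b hb)), neg_add]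
  · rw [neg_le_neg_iff, WithZero.log_le_log (he0 _ (hR0 b hb)) (he0 _ (hR0 a ha)), map_le_map_iff]
    constructor
    · rintro ⟨c, rfl⟩
      exact ⟨c, by rw [Algebra.smul_def, mul_comm, map_mul]⟩
    · rintro ⟨c, hc⟩
      refine ⟨c, IsFractionRing.injective R K ?_⟩
      rw [map_mul, mul_comm, ← hc, Algebra.smul_def]
  · obtain ⟨x, hx⟩ : ∃ x, ValuationRing.valuation R K x = e.symm (WithZero.exp (-g)) :=
      Quotient.mk''_surjective _
    have hx1 : x ∈ (ValuationRing.valuation R K).integer := by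
      rw [Valuation.mem_integer_iff, hx, ← map_one e.symm, map_le_map_iff, ← WithZero.exp_zero,
        WithZero.exp_le_exp]
      exact neg_nonpos.2 hg
    obtain ⟨a, rfl⟩ := (ValuationRing.mem_integer_iff R K x).1 hx1
    refine ⟨a, ?_, ?_⟩
    · rintro rfl
      rw [map_zero, map_zero, eq_comm] at hx
      have := congrArg e hx
      rw [e.apply_symm_apply, map_zero] at this
      exact WithZero.exp_ne_zero this
    · rw [hx, e.apply_symm_apply, WithZero.log_exp, neg_neg]

end ValueGroup

/-! ### Pinching ideals and the value group `ℤ × ℤ` -/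

/-- `Q` is a non-principal prime ideal and every non-principal ideal of `R` is a multiple `yQ`. -/
structure IsPinchingIdeal {R : Type*} [CommRing R] (Q : Ideal R) : Prop where
  isPrime : Q.IsPrime
  ne_span : ∀ a, Q ≠ Ideal.span {a}
  eq_span_or : ∀ I : Ideal R, (∃ a, I = Ideal.span {a}) ∨ ∃ y, I = Ideal.span {y} * Q

/-- An ideal that is stable under division by a nonunit is not principal. -/
theorem eq_bot_of_forall_eq_mul {R : Type*} [CommRing R] [IsDomain R] {π : R} (hπ : ¬ IsUnit π)
    {I : Ideal R} (h : ∀ r ∈ I, ∃ r' ∈ I, r = π * r') (z : R) (hz : I = Ideal.span {z}) :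
    I = ⊥ := by
  obtain ⟨w, hw, hzw⟩ := h z (hz ▸ Ideal.mem_span_singleton_self z)
  rw [hz] at hw
  obtain ⟨v, rfl⟩ := Ideal.mem_span_singleton.1 hw
  rw [hz, Ideal.span_singleton_eq_bot]
  by_contra h0
  refine hπ (IsUnit.of_mul_eq_one v (mul_left_cancel₀ h0 ?_))
  linear_combination -hzw

/-- A domain `R` has value group `Γ` if `Γ` embeds in the multiplicative group of a field
containing `R` in such a way that `Γ ∩ R` is the nonnegative part of `Γ` and every nonzero
element of `R` is the product of a unit of `R` and an element of `Γ`. -/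
theorem exists_isValueMap_of_section {R K Γ : Type*} [CommRing R] [IsDomain R] [Field K]
    [Algebra R K] [FaithfulSMul R K] [AddCommGroup Γ] [LinearOrder Γ] [IsOrderedAddMonoid Γ]
    (φ : Γ → K) (hne : ∀ g, φ g ≠ 0) (hadd : ∀ g h, φ (g + h) = φ g * φ h)
    (hint : ∀ g, 0 ≤ g → ∃ a : R, algebraMap R K a = φ g)
    (hpos : ∀ g, 0 < g → ∀ a : R, algebraMap R K a = φ g → ¬ IsUnit a)
    (hrep : ∀ r : R, r ≠ 0 →
      ∃ (g : Γ) (ε : R), IsUnit ε ∧ algebraMap R K r = algebraMap R K ε * φ g) :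
    ∃ u : R → Γ, IsValueMap u := by
  have hinj : Function.Injective (algebraMap R K) := FaithfulSMul.algebraMap_injective R K
  have h0 : φ 0 = 1 := by
    have := hadd 0 0
    rw [add_zero] at this
    exact (mul_eq_left₀ (hne 0)).1 this.symm
  have hnn : ∀ g, ∀ a : R, algebraMap R K a = φ g → 0 ≤ g := fun g a ha => by
    by_contra hg
    have hg' : 0 < -g := neg_pos.2 (not_le.1 hg)
    obtain ⟨b, hb⟩ := hint (-g) hg'.le
    refine hpos _ hg' b hb (IsUnit.of_mul_eq_one a (hinj ?_))
    rw [map_mul, ha, hb, ← hadd, neg_add_cancel, h0, map_one]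
  let rep : R → Γ → Prop := fun r g => ∃ ε : R, IsUnit ε ∧ algebraMap R K r = algebraMap R K ε * φ g
  have hdvd : ∀ a b g h, rep a g → rep b h → (a ∣ b ↔ g ≤ h) := by
    rintro a b g h ⟨ε, hε, ha⟩ ⟨η, hη, hb⟩
    obtain ⟨ε, rfl⟩ := hε
    obtain ⟨η, rfl⟩ := hη
    have hgh : φ h = φ g * φ (h - g) := by rw [← hadd, add_sub_cancel]
    have hη' : algebraMap R K η * algebraMap R K (η⁻¹ : Rˣ) = 1 := by
      rw [← map_mul, Units.mul_inv, map_one]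
    have hε' : algebraMap R K ε * algebraMap R K (ε⁻¹ : Rˣ) = 1 := by
      rw [← map_mul, Units.mul_inv, map_one]
    constructor
    · rintro ⟨c, rfl⟩
      rw [← sub_nonneg]
      refine hnn _ ((η⁻¹ : Rˣ) * ε * c) (mul_left_cancel₀ (hne g) ?_)
      rw [← hgh]
      rw [map_mul, ha] at hb
      rw [map_mul, map_mul]
      linear_combination (algebraMap R K (η⁻¹ : Rˣ)) * hb + φ h * hη'
    · intro hle
      obtain ⟨c, hc⟩ := hint (h - g) (sub_nonneg.2 hle)
      refine ⟨(ε⁻¹ : Rˣ) * η * c, hinj ?_⟩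
      rw [map_mul, map_mul, map_mul, hc, ha, hb, hgh]
      linear_combination (-algebraMap R K η * φ g * φ (h - g)) * hε'
  have huniq : ∀ a g h, rep a g → rep a h → g = h := fun a g h hg hh =>
    le_antisymm ((hdvd a a g h hg hh).1 dvd_rfl) ((hdvd a a h g hh hg).1 dvd_rfl)
  have hrep' : ∀ r : R, ∃ g, r ≠ 0 → rep r g := fun r => by
    by_cases hr : r = 0
    · exact ⟨0, fun h => absurd hr h⟩
    · obtain ⟨g, hg⟩ := hrep r hr
      exact ⟨g, fun _ => hg⟩
  choose u hu using hrep'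
  refine ⟨u, ⟨fun a b ha hb => ?_, fun a b ha hb => hdvd _ _ _ _ (hu a ha) (hu b hb)⟩,
    fun g hg => ?_⟩
  · refine huniq (a * b) _ _ (hu _ (mul_ne_zero ha hb)) ?_
    obtain ⟨ε, hε, hεa⟩ := hu a ha
    obtain ⟨η, hη, hηb⟩ := hu b hb
    exact ⟨ε * η, hε.mul hη, by rw [map_mul, hεa, hηb, hadd, map_mul]; ring⟩
  · obtain ⟨a, ha⟩ := hint g hg
    have ha0 : a ≠ 0 := by
      rintro rfl
      exact hne g (by rw [← ha, map_zero])
    exact ⟨a, ha0, huniq a _ _ (hu a ha0) ⟨1, isUnit_one, by rw [ha, map_one, one_mul]⟩⟩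

namespace IsPinchingIdeal

variable {R : Type*} [CommRing R] {Q : Ideal R} (hQ : IsPinchingIdeal Q)
include hQ

theorem ne_bot : Q ≠ ⊥ := fun h => hQ.ne_span 0 (by simp [h])

theorem exists_eq_span_of_lt {I : Ideal R} (h : Q < I) : ∃ a, I = Ideal.span {a} :=
  (hQ.eq_span_or I).resolve_right fun ⟨_, hy⟩ => h.not_ge (hy.le.trans Ideal.mul_le_right)

theorem exists_eq_mul_of_forall_eq_mul [IsDomain R] {π : R} (hπ : ¬ IsUnit π) {I : Ideal R}
    (h0 : I ≠ ⊥) (h : ∀ r ∈ I, ∃ r' ∈ I, r = π * r') : ∃ y, I = Ideal.span {y} * Q :=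
  (hQ.eq_span_or I).resolve_left fun ⟨z, hz⟩ => h0 (eq_bot_of_forall_eq_mul hπ h z hz)

variable [IsDomain R] [IsLocalRing R]

/-- If `Q` is not the maximal ideal, then the maximal ideal is generated by some `π`, the ideal `Q`
is the intersection of the powers of `(π)`, and `Q` becomes principal after inverting `π`, with
generator `p`, say. The nonzero elements of `R` are the products `ε π ^ a p ^ b` with `ε` a unit. -/
theorem exists_isValueMap_lex (hQM : Q ≠ IsLocalRing.maximalIdeal R) :
    ∃ u : R → ℤ ×ₗ ℤ, IsValueMap u := by
  have hQlt : Q < IsLocalRing.maximalIdeal R :=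
    lt_of_le_of_ne (IsLocalRing.le_maximalIdeal hQ.isPrime.ne_top) hQM
  obtain ⟨π, hπM⟩ := hQ.exists_eq_span_of_lt hQlt
  have hπ : ¬ IsUnit π := by
    rw [← mem_nonunits_iff, ← IsLocalRing.mem_maximalIdeal, hπM]
    exact Ideal.mem_span_singleton_self π
  have hunit : ∀ r, ¬ π ∣ r → IsUnit r := fun r hr => by
    by_contra h
    rw [← mem_nonunits_iff, ← IsLocalRing.mem_maximalIdeal, hπM, Ideal.mem_span_singleton] at h
    exact hr h
  have hπ0 : π ≠ 0 := by
    rintro rfl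
    rw [hπM] at hQlt
    simp at hQlt
  have hπQ : π ∉ Q := fun h => hQlt.not_ge (hπM ▸ (Ideal.span_singleton_le_iff_mem Q).2 h)
  have hpow : ∀ n, π ^ n ∉ Q := fun n h => hπQ (hQ.isPrime.mem_of_pow_mem n h)
  have hdiv : ∀ q ∈ Q, ∃ q' ∈ Q, q = π * q' := fun q hq => by
    obtain ⟨q', rfl⟩ := Ideal.mem_span_singleton.1 (hπM ▸ hQlt.le hq)
    exact ⟨q', (hQ.isPrime.mem_or_mem hq).resolve_left hπQ, rfl⟩
  have hdivn : ∀ n, ∀ q ∈ Q, ∃ q' ∈ Q, q = π ^ n * q' := fun n => by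
    induction n with
    | zero => exact fun q hq => ⟨q, hq, by simp⟩
    | succ n ih =>
      intro q hq
      obtain ⟨q', hq', rfl⟩ := ih q hq
      obtain ⟨q'', hq'', rfl⟩ := hdiv q' hq'
      exact ⟨q'', hq'', by ring⟩
  -- the ideals `x R[π⁻¹] ∩ R`
  let sat : R → Ideal R := fun x =>
    { carrier := {r | ∃ n, x ∣ π ^ n * r}
      zero_mem' := ⟨0, by simp⟩
      add_mem' := by
        rintro a b ⟨n, hn⟩ ⟨m, hm⟩
        refine ⟨n + m, ?_⟩
        have : π ^ (n + m) * (a + b) = π ^ m * (π ^ n * a) + π ^ n * (π ^ m * b) := by ring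
        rw [this]
        exact dvd_add (hn.mul_left _) (hm.mul_left _)
      smul_mem' := by
        rintro c a ⟨n, hn⟩
        refine ⟨n, ?_⟩
        rw [smul_eq_mul, mul_left_comm]
        exact hn.mul_left _ }
  have hsatQ : ∀ x ∈ Q, ∀ r ∈ sat x, r ∈ Q := by
    rintro x hx r ⟨n, c, hc⟩
    exact (hQ.isPrime.mem_or_mem (hc ▸ Q.mul_mem_right c hx)).resolve_left (hpow n)
  have hsat_div : ∀ x, ∀ r, π * r ∈ sat x → r ∈ sat x := by
    rintro x r ⟨n, hn⟩
    exact ⟨n + 1, by rwa [pow_succ, mul_assoc]⟩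
  -- elements outside `Q`
  have hnotQ : ∀ r, r ∉ Q → ∃ (n : ℕ) (ε : R), IsUnit ε ∧ r = π ^ n * ε := by
    intro r hr
    have hex : ∃ n, ¬ π ^ n ∣ r := by
      by_contra! hall
      let T : Ideal R := ⨅ n : ℕ, Ideal.span {π ^ n}
      have hT : ∀ s, s ∈ T ↔ ∀ n : ℕ, π ^ n ∣ s := fun s => by
        simp only [T, Ideal.mem_iInf, Ideal.mem_span_singleton]
      have hT0 : T ≠ ⊥ := fun h0 => hr <| by
        have : r ∈ T := (hT r).2 hall
        rw [h0] at this
        rw [(Submodule.mem_bot R).1 this]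
        exact Q.zero_mem
      obtain ⟨y, hy⟩ := hQ.exists_eq_mul_of_forall_eq_mul hπ hT0 fun s hs => by
        obtain ⟨s', rfl⟩ := (hT s).1 hs 1
        rw [pow_one] at *
        refine ⟨s', (hT s').2 fun n => ?_, rfl⟩
        have := (hT _).1 hs (n + 1)
        rw [pow_succ'] at this
        exact (mul_dvd_mul_iff_left hπ0).1 this
      exact hr (Ideal.mul_le_right (hy ▸ (hT r).2 hall : r ∈ Ideal.span {y} * Q))
    classical
    have hn := Nat.find_spec hex
    have hmin := fun m => Nat.find_min hex (m := m)
    obtain ⟨n, hn'⟩ : ∃ n, Nat.find hex = n + 1 := by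
      refine Nat.exists_eq_succ_of_ne_zero fun h0 => ?_
      rw [h0] at hn
      simp at hn
    rw [hn'] at hn
    obtain ⟨ε, rfl⟩ := not_not.1 (hmin n (by omega))
    refine ⟨n, ε, hunit ε fun h => hn ?_, rfl⟩
    rw [pow_succ]
    exact mul_dvd_mul_left _ h
  obtain ⟨p, hpQ, hp0, hp⟩ : ∃ p ∈ Q, p ≠ 0 ∧ ∀ q ∈ Q, q ∈ sat p := by
    obtain ⟨x, hxQ, hx0⟩ := Submodule.exists_mem_ne_zero_of_ne_bot hQ.ne_bot
    have hxs : x ∈ sat x := ⟨0, by simp⟩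
    obtain ⟨y, hy⟩ := hQ.exists_eq_mul_of_forall_eq_mul hπ (I := sat x)
      (fun h0 => hx0 (by rwa [h0, Submodule.mem_bot] at hxs)) fun r hr => by
        obtain ⟨r', -, rfl⟩ := hdiv r (hsatQ x hxQ r hr)
        exact ⟨r', hsat_div x r' hr, rfl⟩
    obtain ⟨p, hpQ, hyp⟩ := Ideal.mem_span_singleton_mul.1 (hy ▸ hxs)
    have hy0 : y ≠ 0 := by rintro rfl; simp [eq_comm, hx0] at hyp
    refine ⟨p, hpQ, ?_, fun q hq => ?_⟩
    · rintro rfl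
      simp [eq_comm, hx0] at hyp
    obtain ⟨n, hn⟩ : y * q ∈ sat x := hy ▸ Ideal.mul_mem_mul (Ideal.mem_span_singleton_self y) hq
    refine ⟨n, ?_⟩
    rw [← hyp, mul_left_comm] at hn
    exact (mul_dvd_mul_iff_left hy0).1 hn
  -- the powers of `p R[π⁻¹]` intersect in zero
  have hinter : ∀ r, r ≠ 0 → ∃ b, r ∉ sat (p ^ b) := by
    intro r hr
    by_contra! hall
    let T : Ideal R := ⨅ n : ℕ, sat (p ^ n)
    have hT : ∀ s, s ∈ T ↔ ∀ n : ℕ, s ∈ sat (p ^ n) := fun s => by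
      simp only [T, Ideal.mem_iInf]
    have hrT := (hT r).2 hall
    obtain ⟨y, hy⟩ := hQ.exists_eq_mul_of_forall_eq_mul hπ (I := T)
      (fun h0 => hr (by rwa [h0, Submodule.mem_bot] at hrT)) fun s hs => by
        obtain ⟨s', -, rfl⟩ := hdiv s (hsatQ p hpQ s (by simpa using (hT s).1 hs 1))
        exact ⟨s', (hT s').2 fun n => hsat_div _ _ ((hT _).1 hs n), rfl⟩
    have hy0 : y ≠ 0 := by
      rintro rfl
      rw [hy] at hrT
      simp [hr] at hrT
    have hyp : y * p ∈ T := hy ▸ Ideal.mul_mem_mul (Ideal.mem_span_singleton_self y) hpQ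
    have hyT : y ∈ T := (hT y).2 fun n => by
      obtain ⟨m, hm⟩ := (hT _).1 hyp (n + 1)
      rw [pow_succ, ← mul_assoc] at hm
      exact ⟨m, (mul_dvd_mul_iff_right hp0).1 hm⟩
    obtain ⟨q, hq, hyq⟩ := Ideal.mem_span_singleton_mul.1 (hy ▸ hyT)
    rw [mul_eq_left₀ hy0] at hyq
    exact hQ.isPrime.ne_top ((Ideal.eq_top_iff_one Q).2 (hyq ▸ hq))
  have hrepr : ∀ r, r ≠ 0 → ∃ (b m n : ℕ) (ε : R), IsUnit ε ∧ π ^ n * r = p ^ b * (π ^ m * ε) := by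
    intro r hr
    classical
    have hex := hinter r hr
    have hn := Nat.find_spec hex
    have hmin := fun m => Nat.find_min hex (m := m)
    obtain ⟨b, hb⟩ : ∃ n, Nat.find hex = n + 1 := by
      refine Nat.exists_eq_succ_of_ne_zero fun h0 => hn ⟨0, ?_⟩
      rw [h0]
      simp
    rw [hb] at hn
    obtain ⟨n, s, hs⟩ := not_not.1 (hmin b (by omega))
    have hsQ : s ∉ Q := fun hsQ => hn <| by
      obtain ⟨m, hm⟩ := hp s hsQ
      refine ⟨m + n, ?_⟩
      rw [pow_succ p, pow_add, mul_assoc, hs, mul_left_comm]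
      exact mul_dvd_mul_left _ hm
    obtain ⟨m, ε, hε, rfl⟩ := hnotQ s hsQ
    exact ⟨b, m, n, ε, hε, hs⟩
  set K := FractionRing R
  have hπK : algebraMap R K π ≠ 0 := by simpa using hπ0
  have hpK : algebraMap R K p ≠ 0 := by simpa using hp0
  have hinj : Function.Injective (algebraMap R K) := FaithfulSMul.algebraMap_injective R K
  have hφpos : ∀ (b : ℕ) (a : ℤ), ∃ q ∈ Q,
      algebraMap R K q = algebraMap R K p ^ (b + 1) * algebraMap R K π ^ a := by
    intro b a
    obtain ⟨q, hq, hpq⟩ := hdivn a.natAbs p hpQ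
    refine ⟨p ^ b * (π ^ (a + a.natAbs).toNat * q), Q.mul_mem_left _ (Q.mul_mem_left _ hq), ?_⟩
    have h1 : algebraMap R K π ^ (a + a.natAbs).toNat =
        algebraMap R K π ^ a * algebraMap R K π ^ a.natAbs := by
      rw [← zpow_natCast, ← zpow_natCast, ← zpow_add₀ hπK, Int.toNat_of_nonneg (by omega)]
    have h2 := congrArg (algebraMap R K) hpq
    rw [map_mul, map_pow] at h2
    rw [map_mul, map_mul, map_pow, map_pow, h1]
    linear_combination (-algebraMap R K p ^ b * algebraMap R K π ^ a) * h2
  have hcast : ∀ b : ℤ, 0 < b →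
      algebraMap R K p ^ b = algebraMap R K p ^ (b.toNat - 1 + 1) := fun b hb => by
    rw [← zpow_natCast]
    congr 1
    omega
  refine exists_isValueMap_of_section (K := K)
    (fun g => algebraMap R K p ^ (ofLex g).1 * algebraMap R K π ^ (ofLex g).2) ?_ ?_ ?_ ?_ ?_
  · exact fun g => mul_ne_zero (zpow_ne_zero _ hpK) (zpow_ne_zero _ hπK)
  · intro g h
    simp only [ofLex_add, Prod.fst_add, Prod.snd_add, zpow_add₀ hpK, zpow_add₀ hπK]
    ring
  · intro g hg
    rcases Prod.Lex.le_iff.1 hg with h | ⟨h, h'⟩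
    · obtain ⟨q, -, hq⟩ := hφpos ((ofLex g).1.toNat - 1) (ofLex g).2
      exact ⟨q, by rw [hq, hcast _ h]⟩
    · refine ⟨π ^ (ofLex g).2.toNat, ?_⟩
      rw [← h, map_pow, ← zpow_natCast, Int.toNat_of_nonneg h']
      simp
  · intro g hg a ha
    rcases Prod.Lex.lt_iff.1 hg with h | ⟨h, h'⟩
    · obtain ⟨q, hqQ, hq⟩ := hφpos ((ofLex g).1.toNat - 1) (ofLex g).2
      have : a = q := hinj (by rw [ha, hq, hcast _ h])
      exact fun hu => hQ.isPrime.ne_top (Ideal.eq_top_of_isUnit_mem Q hqQ (this ▸ hu))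
    · have : a = π ^ (ofLex g).2.toNat := by
        refine hinj ?_
        rw [ha, ← h, map_pow, ← zpow_natCast, Int.toNat_of_nonneg (le_of_lt h')]
        simp
      have h'' : 0 < (ofLex g).2 := h'
      rw [this, isUnit_pow_iff (by omega)]
      exact hπ
  · intro r hr
    obtain ⟨b, m, n, ε, hε, h⟩ := hrepr r hr
    refine ⟨toLex (b, m - n), ε, hε, ?_⟩
    have h' := congrArg (algebraMap R K) h
    simp only [map_mul, map_pow] at h'
    simp only [ofLex_toLex, zpow_sub₀ hπK, zpow_natCast]
    rw [mul_div_assoc', mul_div_assoc', eq_div_iff (pow_ne_zero n hπK)]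
    linear_combination h'

end IsPinchingIdeal

/-! ### Pinching by a finitely generated maximal ideal: pseudo-valuation domains -/

open IsLocalRing

section PVD

theorem algebraMap_mem_colonRing {R : Type*} [CommRing R] (I : Ideal R) (r : R) :
    algebraMap R (FractionRing R) r ∈ colonRing I := by
  rintro _ ⟨i, hi, rfl⟩
  exact ⟨r * i, I.mul_mem_left r hi, map_mul _ _ _⟩

variable {R : Type*} [CommRing R] [IsDomain R] [IsLocalRing R]

/-- The two conditions say that `V = M : M` is a valuation ring and that `M` contains every nonunit
of `V`. -/
theorem isPVD_of_inv_mem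
    (hV : ∀ x : FractionRing R, x ∈ colonRing (maximalIdeal R) ∨ x⁻¹ ∈ colonRing (maximalIdeal R))
    (hloc : ∀ x ∈ colonRing (maximalIdeal R), x ∉ idealImage (maximalIdeal R) →
      x⁻¹ ∈ colonRing (maximalIdeal R)) : IsPVD R := by
  refine ⟨‹_›, ?_, ?_⟩
  · refine ValuationRing.iff_dvd_total.2 ⟨fun a b => ?_⟩
    by_cases ha : a = 0
    · exact Or.inr (ha ▸ dvd_zero b)
    by_cases hb : b = 0
    · exact Or.inl (hb ▸ dvd_zero a)
    have ha' : (a : FractionRing R) ≠ 0 := by simpa using ha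
    have hb' : (b : FractionRing R) ≠ 0 := by simpa using hb
    rcases hV (b / a) with h | h
    · exact Or.inl ⟨⟨_, h⟩, Subtype.ext (mul_div_cancel₀ _ ha').symm⟩
    · rw [inv_div] at h
      exact Or.inr ⟨⟨_, h⟩, Subtype.ext (mul_div_cancel₀ _ hb').symm⟩
  · let N : Ideal (colonRing (maximalIdeal R)) :=
      { carrier := {x | (x : FractionRing R) ∈ idealImage (maximalIdeal R)}
        zero_mem' := ⟨0, zero_mem _, map_zero _⟩
        add_mem' := by
          rintro a b ⟨r, hr, hra⟩ ⟨s, hs, hsb⟩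
          exact ⟨r + s, add_mem hr hs, by rw [map_add, hra, hsb]; rfl⟩
        smul_mem' := fun c x hx => c.2 _ hx }
    refine ⟨N, Ideal.isMaximal_iff.2 ⟨?_, ?_⟩, ?_⟩
    · rintro ⟨r, hr, hr1⟩
      have : r = 1 := IsFractionRing.injective R (FractionRing R) (by rw [hr1, map_one]; rfl)
      exact (Ideal.ne_top_iff_one _).1 (maximalIdeal.isMaximal R).ne_top (this ▸ hr)
    · intro J x _ hxN hxJ
      have hx0 : (x : FractionRing R) ≠ 0 := fun h0 => hxN ⟨0, zero_mem _, by rw [map_zero, h0]⟩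
      have : (⟨_, hloc x x.2 hxN⟩ : colonRing (maximalIdeal R)) * x = 1 :=
        Subtype.ext (inv_mul_cancel₀ hx0)
      exact this ▸ J.mul_mem_left _ hxJ
    · ext x
      constructor
      · rintro ⟨y, hy, rfl⟩
        exact hy
      · rintro ⟨r, hr, rfl⟩
        exact ⟨⟨_, algebraMap_mem_colonRing _ r⟩, ⟨r, hr, rfl⟩, rfl⟩

theorem isPVD_of_valuationRing {R : Type*} [CommRing R] [IsDomain R] [ValuationRing R] :
    IsPVD R := by
  have key : ∀ x : FractionRing R, x ∈ (algebraMap R (FractionRing R)).range ∨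
      x⁻¹ ∈ (algebraMap R (FractionRing R)).range := fun x =>
    (ValuationRing.isInteger_or_isInteger R x)
  refine isPVD_of_inv_mem (fun x => (key x).imp ?_ ?_) fun x _ hxM => ?_
  · rintro ⟨r, rfl⟩
    exact algebraMap_mem_colonRing _ r
  · rintro ⟨r, hr⟩
    exact hr ▸ algebraMap_mem_colonRing _ r
  · rcases key x with ⟨r, rfl⟩ | ⟨r, hr⟩
    · have hr : IsUnit r := by
        by_contra hr
        exact hxM ⟨r, hr, rfl⟩
      obtain ⟨ε, rfl⟩ := hr
      rw [← map_units_inv]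
      exact algebraMap_mem_colonRing _ _
    · exact hr ▸ algebraMap_mem_colonRing _ r

theorem isTwoGenerated_of_isPrincipalIdealRing {R : Type*} [CommRing R] [IsPrincipalIdealRing R] :
    IsTwoGenerated R := fun I => by
  obtain ⟨a, ha⟩ := IsPrincipalIdealRing.principal I
  exact ⟨a, a, by rw [ha, Set.pair_eq_singleton]⟩

end PVD

namespace IsPinchingIdeal

variable {R : Type*} [CommRing R] [IsLocalRing R] (hM : IsPinchingIdeal (maximalIdeal R))
include hM

theorem not_maximalIdeal_le_mul (hfg : (maximalIdeal R).FG) :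
    ¬ maximalIdeal R ≤ maximalIdeal R * maximalIdeal R := fun hle =>
  hM.ne_bot (Submodule.eq_bot_of_le_smul_of_le_jacobson_bot _ _ hfg hle
    (maximalIdeal_le_jacobson _))

/-- If `x ∈ M \ M²` and `y ∈ M \ (xR + M²)`, then `(x, y)` is not principal, so it is `zM` for
some `z`, which is a unit because `x ∉ M²`. -/
theorem isTwoGenerated (hfg : (maximalIdeal R).FG) : IsTwoGenerated R := by
  have hgen : ∃ x y, maximalIdeal R = Ideal.span {x, y} := by
    obtain ⟨x, hx, hx2⟩ := SetLike.not_le_iff_exists.1 (hM.not_maximalIdeal_le_mul hfg)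
    obtain ⟨y, hy, hy2⟩ : ∃ y ∈ maximalIdeal R,
        y ∉ Ideal.span {x} ⊔ maximalIdeal R * maximalIdeal R := by
      refine SetLike.not_le_iff_exists.1 fun hle => hM.ne_span x (le_antisymm ?_ ?_)
      · exact Submodule.le_of_le_smul_of_le_jacobson_bot hfg (maximalIdeal_le_jacobson _) hle
      · exact (Ideal.span_singleton_le_iff_mem _).2 hx
    refine ⟨x, y, ?_⟩
    have hxs : x ∈ Ideal.span {x, y} := Ideal.subset_span (by simp)
    have hys : y ∈ Ideal.span {x, y} := Ideal.subset_span (by simp)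
    have hsM : Ideal.span {x, y} ≤ maximalIdeal R := Ideal.span_le.2 (by
      rintro z (rfl | rfl)
      exacts [hx, hy])
    rcases hM.eq_span_or (Ideal.span {x, y}) with ⟨z, hz⟩ | ⟨z, hz⟩
    · exfalso
      obtain ⟨a, rfl⟩ := Ideal.mem_span_singleton.1 (hz ▸ hxs)
      have hzM : z ∈ maximalIdeal R := hsM (hz ▸ Ideal.mem_span_singleton_self z)
      have ha : IsUnit a := by
        by_contra ha
        exact hx2 (Ideal.mul_mem_mul hzM ha)
      refine hy2 (Ideal.mem_sup_left ?_)
      rw [Ideal.span_singleton_mul_right_unit ha, ← hz]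
      exact hys
    · have hzu : IsUnit z := by
        by_contra hzu
        exact hx2 (Ideal.mul_mono_left ((Ideal.span_singleton_le_iff_mem _).2 hzu)
          (hz ▸ hxs))
      rw [hz, Ideal.span_singleton_eq_top.2 hzu, Ideal.top_mul]
  obtain ⟨x, y, hxy⟩ := hgen
  intro I
  rcases hM.eq_span_or I with ⟨a, ha⟩ | ⟨z, hz⟩
  · exact ⟨a, a, by rw [ha, Set.pair_eq_singleton]⟩
  · refine ⟨z * x, z * y, ?_⟩
    rw [hz, hxy, Ideal.span_mul_span', Set.singleton_mul, Set.image_pair]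

variable [IsDomain R]

theorem not_isInvertibleIdeal_maximalIdeal : ¬ IsInvertibleIdeal (maximalIdeal R) := fun h => by
  obtain ⟨a, -, ha⟩ := h.exists_eq_span
  exact hM.ne_span a ha

/-- A nonzero multiple of the maximal ideal is not principal, since the maximal ideal is not
invertible. -/
theorem exists_mul_maximalIdeal_eq {I : Ideal R} (hI : I ≠ ⊥) :
    ∃ y ≠ 0, I * maximalIdeal R = Ideal.span {y} * maximalIdeal R := by
  have hne : I * maximalIdeal R ≠ ⊥ := by
    rw [Ne, Ideal.mul_eq_bot, not_or]
    exact ⟨hI, hM.ne_bot⟩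
  rcases hM.eq_span_or (I * maximalIdeal R) with ⟨a, ha⟩ | ⟨y, hy⟩
  · refine absurd (IsInvertibleIdeal.of_mul_eq_span (X := I) (c := a) ?_ ?_)
      hM.not_isInvertibleIdeal_maximalIdeal
    · rintro rfl
      simp [ha] at hne
    · rw [mul_comm, ha]
  · refine ⟨y, ?_, hy⟩
    rintro rfl
    simp [hy] at hne

/-- Let `V = M : M` and `M² = wM`. For `v ∈ V \ M` the ideal `vM` of `R` is a multiple `yM` with `y`
a unit, so `v⁻¹ ∈ V`; and `(a, b)M = yM` shows that `a / y` and `b / y` lie in `V`, not both of them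
in `M`, so `V` is a valuation ring. -/
theorem isPVD (hfg : (maximalIdeal R).FG) : IsPVD R := by
  set K := FractionRing R
  set M := maximalIdeal R
  set V := colonRing M
  have hinj : Function.Injective (algebraMap R K) := IsFractionRing.injective R K
  have hR0 : ∀ a : R, a ≠ 0 → algebraMap R K a ≠ 0 := fun a ha => by simpa using ha
  obtain ⟨w, hw0, hw⟩ := hM.exists_mul_maximalIdeal_eq hM.ne_bot
  have hV : ∀ z y : R, y ≠ 0 → (∀ m ∈ M, z * m ∈ Ideal.span {y} * M) →
      algebraMap R K z / algebraMap R K y ∈ V := by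
    rintro z y hy h _ ⟨m, hm, rfl⟩
    obtain ⟨m', hm', h'⟩ := Ideal.mem_span_singleton_mul.1 (h m hm)
    refine ⟨m', hm', mul_left_cancel₀ (hR0 y hy) ?_⟩
    rw [← map_mul, h', map_mul, ← mul_assoc, mul_div_cancel₀ _ (hR0 y hy)]
  have hwV : ∀ m ∈ M, algebraMap R K m / algebraMap R K w ∈ V := fun m hm =>
    hV m w hw0 fun m' hm' => hw ▸ Ideal.mul_mem_mul hm hm'
  have hloc : ∀ v ∈ V, v ∉ idealImage M → v⁻¹ ∈ V := by
    intro v hv hvM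
    have hv0 : v ≠ 0 := by
      rintro rfl
      exact hvM ⟨0, zero_mem _, map_zero _⟩
    -- the ideal `vM`
    let I : Ideal R :=
      { carrier := {r | ∃ m ∈ M, algebraMap R K r = v * algebraMap R K m}
        zero_mem' := ⟨0, zero_mem _, by simp⟩
        add_mem' := by
          rintro a b ⟨m, hm, ha⟩ ⟨n, hn, hb⟩
          exact ⟨m + n, add_mem hm hn, by rw [map_add, ha, hb, map_add, mul_add]⟩
        smul_mem' := by
          rintro c a ⟨m, hm, ha⟩
          exact ⟨c * m, M.mul_mem_left c hm, by
            rw [smul_eq_mul, map_mul, ha, map_mul, mul_left_comm]⟩ }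
    have hvI : ∀ m ∈ M, ∃ r ∈ I, algebraMap R K r = v * algebraMap R K m := fun m hm => by
      obtain ⟨r, hr, h⟩ := hv _ ⟨m, hm, rfl⟩
      exact ⟨r, ⟨m, hm, h⟩, h⟩
    rcases hM.eq_span_or I with ⟨c, hc⟩ | ⟨y, hy⟩
    · exfalso
      obtain ⟨m₀, hm₀, hcm⟩ : c ∈ I := hc ▸ Ideal.mem_span_singleton_self c
      refine hM.ne_span m₀ (le_antisymm (fun m hm => ?_)
        ((Ideal.span_singleton_le_iff_mem _).2 hm₀))
      obtain ⟨r, hr, h⟩ := hvI m hm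
      obtain ⟨s, rfl⟩ := Ideal.mem_span_singleton.1 (hc ▸ hr)
      refine Ideal.mem_span_singleton.2 ⟨s, hinj (mul_left_cancel₀ hv0 ?_)⟩
      rw [← h, map_mul, hcm, map_mul, mul_assoc]
    · by_cases hyu : IsUnit y
      · rw [Ideal.span_singleton_eq_top.2 hyu, Ideal.top_mul] at hy
        rintro _ ⟨m, hm, rfl⟩
        obtain ⟨n, hn, h⟩ : m ∈ I := hy ▸ hm
        exact ⟨n, hn, by rw [h, inv_mul_cancel_left₀ hv0]⟩
      · exfalso
        have hwM : w ∈ M := fun hwu => by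
          rw [Ideal.span_singleton_eq_top.2 hwu, Ideal.top_mul] at hw
          exact hM.not_maximalIdeal_le_mul hfg hw.ge
        obtain ⟨r, hr, h⟩ := hvI w hwM
        obtain ⟨m, hm, rfl⟩ := Ideal.mem_span_singleton_mul.1 (hy ▸ hr)
        have hv' : v = algebraMap R K m / algebraMap R K w * algebraMap R K y := by
          rw [div_mul_eq_mul_div, eq_div_iff (hR0 w hw0), ← h, map_mul, mul_comm]
        exact hvM (hv' ▸ hwV m hm _ ⟨y, hyu, rfl⟩)
  refine isPVD_of_inv_mem (fun z => ?_) hloc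
  obtain ⟨a, b, hb, rfl⟩ := IsFractionRing.div_surjective R z
  have hb0 := nonZeroDivisors.ne_zero hb
  have has : a ∈ Ideal.span {a, b} := Ideal.subset_span (by simp)
  have hbs : b ∈ Ideal.span {a, b} := Ideal.subset_span (by simp)
  obtain ⟨y, hy0, hy⟩ := hM.exists_mul_maximalIdeal_eq (I := Ideal.span {a, b})
    fun h0 => hb0 (by rwa [h0, Submodule.mem_bot] at hbs)
  have hay : algebraMap R K a / algebraMap R K y ∈ V :=
    hV a y hy0 fun m hm => hy ▸ Ideal.mul_mem_mul has hm
  have hby : algebraMap R K b / algebraMap R K y ∈ V :=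
    hV b y hy0 fun m hm => hy ▸ Ideal.mul_mem_mul hbs hm
  by_cases hbM : algebraMap R K b / algebraMap R K y ∈ idealImage M
  · by_cases haM : algebraMap R K a / algebraMap R K y ∈ idealImage M
    · exfalso
      have hmem : ∀ c, algebraMap R K c / algebraMap R K y ∈ idealImage M →
          c ∈ Ideal.span {y} * M := by
        rintro c ⟨m, hm, h⟩
        rw [eq_div_iff (hR0 y hy0), ← map_mul] at h
        rw [← hinj h, mul_comm m]
        exact Ideal.mul_mem_mul (Ideal.mem_span_singleton_self y) hm
      have hle : Ideal.span {a, b} ≤ Ideal.span {y} * M := Ideal.span_le.2 (by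
        rintro c (rfl | rfl)
        exacts [hmem _ haM, hmem _ hbM])
      refine hM.not_maximalIdeal_le_mul hfg
        ((isInvertibleIdeal_span_singleton hy0).mul_le_mul_left_iff.1 ?_)
      rw [← mul_assoc]
      exact hy.ge.trans (Ideal.mul_mono_left hle)
    · right
      have := V.mul_mem hby (hloc _ hay haM)
      rwa [inv_div, div_mul_div_cancel₀ (hR0 y hy0), ← inv_div] at this
  · left
    have := V.mul_mem hay (hloc _ hby hbM)
    rwa [inv_div, div_mul_div_cancel₀ (hR0 y hy0)] at this

end IsPinchingIdeal

/-! ### Pinching by a maximal ideal that is not finitely generated: the value group `ℝ` -/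

/-- A valuation ring in which every nonzero element divides a power of each nonunit has an
archimedean value group, which embeds in `ℝ` by Hölder's theorem. -/
theorem exists_isDivisibilityMap_real {R : Type*} [CommRing R] [IsDomain R] [ValuationRing R]
    (harch : ∀ a b : R, ¬ IsUnit a → b ≠ 0 → ∃ n, b ∣ a ^ n) :
    ∃ u : R → ℝ, IsDivisibilityMap u := by
  set K := FractionRing R
  set Γ := ValuationRing.ValueGroup R K
  set v := ValuationRing.valuation R K with hv
  have hle : ∀ a b : R, v (algebraMap R K a) ≤ v (algebraMap R K b) ↔ b ∣ a := fun a b => by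
    constructor
    · rintro ⟨c, hc⟩
      refine ⟨c, IsFractionRing.injective R K ?_⟩
      rw [map_mul, mul_comm, ← hc, Algebra.smul_def]
    · rintro ⟨c, rfl⟩
      exact ⟨c, by rw [Algebra.smul_def, mul_comm, map_mul]⟩
  have h1 : v (algebraMap R K 1) = 1 := by rw [map_one, map_one]
  have hv0 : ∀ a : R, a ≠ 0 → v (algebraMap R K a) ≠ 0 := fun a ha => by
    rw [Ne, Valuation.zero_iff]
    simpa using ha
  have hint : ∀ g : Γ, g ≤ 1 → ∃ a : R, v (algebraMap R K a) = g := fun g hg => by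
    obtain ⟨x, rfl⟩ : ∃ x, v x = g := Quotient.mk''_surjective g
    obtain ⟨a, rfl⟩ := (ValuationRing.mem_integer_iff R K x).1 hg
    exact ⟨a, rfl⟩
  have hMA : MulArchimedean Γˣ := ⟨fun x y hy => by
    rcases le_total x 1 with hx | hx
    · exact ⟨0, by simpa using hx⟩
    obtain ⟨a, ha⟩ := hint (y⁻¹ : Γˣ) (by exact_mod_cast inv_le_one'.2 hy.le)
    obtain ⟨b, hb⟩ := hint (x⁻¹ : Γˣ) (by exact_mod_cast inv_le_one'.2 hx)
    have hb0 : b ≠ 0 := by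
      rintro rfl
      rw [map_zero, map_zero] at hb
      exact (x⁻¹).ne_zero hb.symm
    have hau : ¬ IsUnit a := fun hu => by
      have : v (algebraMap R K 1) ≤ v (algebraMap R K a) := (hle _ _).2 hu.dvd
      rw [h1, ha] at this
      have : 1 ≤ y⁻¹ := by exact_mod_cast this
      exact absurd (one_le_inv'.1 this) (not_le.2 hy)
    obtain ⟨n, hn⟩ := harch a b hau hb0
    refine ⟨n, ?_⟩
    have := (hle _ _).2 hn
    rw [map_pow, map_pow, ha, hb] at this
    have : y⁻¹ ^ n ≤ x⁻¹ := by exact_mod_cast this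
    rwa [inv_pow, inv_le_inv_iff] at this⟩
  obtain ⟨f, hf⟩ := Archimedean.exists_orderAddMonoidHom_real_injective (Additive Γˣ)
  have hfs : StrictMono f := f.monotone'.strictMono_of_injective hf
  classical
  let u : R → ℝ := fun a =>
    if ha : a = 0 then 0 else -f (Additive.ofMul (Units.mk0 (v (algebraMap R K a)) (hv0 a ha)))
  have hu : ∀ a (ha : a ≠ 0),
      u a = -f (Additive.ofMul (Units.mk0 (v (algebraMap R K a)) (hv0 a ha))) :=
    fun a ha => dif_neg ha
  refine ⟨u, fun a b ha hb => ?_, fun a b ha hb => ?_⟩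
  · rw [hu a ha, hu b hb, hu _ (mul_ne_zero ha hb), ← neg_add, ← map_add, ← ofMul_mul]
    congr 4
    ext
    simp
  · rw [hu a ha, hu b hb, neg_le_neg_iff, hfs.le_iff_le, Additive.ofMul_le, ← Units.val_le_val,
      ← hle]
    rfl

namespace IsPinchingIdeal

variable {R : Type*} [CommRing R] [IsDomain R] [IsLocalRing R]
  (hM : IsPinchingIdeal (maximalIdeal R)) (hfg : ¬ (maximalIdeal R).FG)
include hM hfg

theorem valuationRing : ValuationRing R := by
  refine ValuationRing.iff_local_bezout_domain.2 ⟨‹_›, IsBezout.iff_span_pair_isPrincipal.2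
    fun x y => ?_⟩
  rcases hM.eq_span_or (Ideal.span {x, y}) with ⟨a, ha⟩ | ⟨z, hz⟩
  · exact ⟨a, ha⟩
  by_cases hz0 : z = 0
  · exact ⟨0, by rw [hz, hz0]; simp⟩
  refine absurd ?_ hfg
  refine Submodule.fg_of_fg_map_injective (LinearMap.mulLeft R z) (mul_right_injective₀ hz0) ?_
  have : Submodule.map (LinearMap.mulLeft R z) (maximalIdeal R) = Ideal.span {x, y} := by
    rw [hz]
    ext t
    rw [Ideal.mem_span_singleton_mul]
    rfl
  rw [this]
  exact Submodule.fg_span (Set.toFinite _)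

theorem exists_dvd_pow {a b : R} (ha : ¬ IsUnit a) (hb : b ≠ 0) : ∃ n, b ∣ a ^ n := by
  have := hM.valuationRing hfg
  by_contra! hc
  obtain ⟨P, hP, hbP, hdis⟩ := (Ideal.span {b}).exists_le_prime_disjoint (Submonoid.powers a) <| by
    rw [Set.disjoint_left]
    rintro _ hx ⟨n, rfl⟩
    exact hc n (Ideal.mem_span_singleton.1 hx)
  have haP : a ∉ P := fun h => Set.disjoint_left.1 hdis h ⟨1, pow_one a⟩
  have hbP' : b ∈ P := (Ideal.span_singleton_le_iff_mem P).1 hbP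
  rcases hM.eq_span_or P with ⟨z, hz⟩ | ⟨y, hy⟩
  · refine hb ?_
    have : P = ⊥ := by
      refine eq_bot_of_forall_eq_mul ha (fun r hr => ?_) z hz
      obtain ⟨c, rfl⟩ : a ∣ r := (ValuationRing.dvd_total a r).resolve_right fun h =>
        haP (P.mem_of_dvd h hr)
      exact ⟨c, (hP.mem_or_mem hr).resolve_left haP, rfl⟩
    rwa [this, Submodule.mem_bot] at hbP'
  · rcases hP.mul_le.1 hy.ge with h | h
    · have hle : Ideal.span {y} * ⊤ ≤ Ideal.span {y} * maximalIdeal R := by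
        rw [Ideal.mul_top, ← hy]
        exact h
      have hy0 : y ≠ 0 := by
        rintro rfl
        rw [hy] at hbP'
        simp [hb] at hbP'
      exact (maximalIdeal.isMaximal R).ne_top (top_le_iff.1
        ((isInvertibleIdeal_span_singleton hy0).mul_le_mul_left_iff.1 hle))
    · exact haP (h ha)

/-- The value group is archimedean, hence a subgroup of `ℝ`; it is dense because `M` is not
principal, and it is all of `ℝ` because each ideal `{r | u r > t}` is a multiple of `M`. -/
theorem exists_isValueMap_real : ∃ u : R → ℝ, IsValueMap u := by
  have := hM.valuationRing hfg
  obtain ⟨u, hu⟩ := exists_isDivisibilityMap_real fun a b ha hb => hM.exists_dvd_pow hfg ha hb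
  have hpos : ∀ a, a ≠ 0 → (¬ IsUnit a ↔ 0 < u a) := fun a ha => by
    rw [hu.isUnit_iff ha, (hu.nonneg ha).lt_iff_ne, ne_comm]
  -- the infimum of the positive values is `0`, because no nonunit generates the maximal ideal
  have hsmall : ∀ ε > 0, ∃ a, a ≠ 0 ∧ 0 < u a ∧ u a < ε := by
    by_contra! hc
    obtain ⟨ε, hε, hc⟩ := hc
    have hhalf : ∀ a, a ≠ 0 → 0 < u a → ∃ b, b ≠ 0 ∧ 0 < u b ∧ u b ≤ u a / 2 := by
      intro a ha hua
      have haM : a ∈ maximalIdeal R := (hpos a ha).2 hua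
      obtain ⟨b, hbM, hb⟩ := SetLike.not_le_iff_exists.1 fun
        hle : maximalIdeal R ≤ Ideal.span {a} =>
        hM.ne_span a (le_antisymm hle ((Ideal.span_singleton_le_iff_mem _).2 haM))
      rw [Ideal.mem_span_singleton] at hb
      have hb0 : b ≠ 0 := fun h => hb (h ▸ dvd_zero a)
      obtain ⟨c, rfl⟩ := (ValuationRing.dvd_total a b).resolve_left hb
      have hc0 : c ≠ 0 := right_ne_zero_of_mul ha
      have hcu : ¬ IsUnit c := fun hcu => hb ((hcu.mul_right_dvd).2 dvd_rfl)
      have hub := (hpos b hb0).1 hbM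
      have huc := (hpos c hc0).1 hcu
      have huab := hu.map_mul b c hb0 hc0
      rcases le_total (u b) (u c) with h | h
      · exact ⟨b, hb0, hub, by linarith⟩
      · exact ⟨c, hc0, huc, by linarith⟩
    obtain ⟨a, ha, ha0⟩ := Submodule.exists_mem_ne_zero_of_ne_bot hM.ne_bot
    have hiter : ∀ n : ℕ, ∃ b, b ≠ 0 ∧ 0 < u b ∧ u b ≤ u a / 2 ^ n := by
      intro n
      induction n with
      | zero => exact ⟨a, ha0, (hpos a ha0).1 ha, by simp⟩
      | succ n ih =>
        obtain ⟨b, hb0, hub, hb⟩ := ih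
        obtain ⟨c, hc0, huc, hc⟩ := hhalf b hb0 hub
        refine ⟨c, hc0, huc, hc.trans ?_⟩
        rw [pow_succ, ← div_div]
        linarith
    obtain ⟨n, hn⟩ := pow_unbounded_of_one_lt (u a / ε) (one_lt_two)
    obtain ⟨b, hb0, hub, hb⟩ := hiter n
    have := hc b hb0 hub
    rw [div_lt_iff₀ hε] at hn
    rw [le_div_iff₀ (by positivity)] at hb
    nlinarith [pow_pos (two_pos : (0 : ℝ) < 2) n]
  have hdense : ∀ s t : ℝ, 0 ≤ s → s < t → ∃ r, r ≠ 0 ∧ s < u r ∧ u r < t := by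
    intro s t hs hst
    obtain ⟨a, ha0, hua, hat⟩ := hsmall (t - s) (sub_pos.2 hst)
    refine ⟨a ^ (⌊s / u a⌋₊ + 1), pow_ne_zero _ ha0, ?_, ?_⟩
    · rw [hu.map_pow ha0, nsmul_eq_mul]
      have := Nat.lt_floor_add_one (s / u a)
      rw [div_lt_iff₀ hua] at this
      exact_mod_cast this
    · rw [hu.map_pow ha0, nsmul_eq_mul]
      have := Nat.floor_le (div_nonneg hs hua.le)
      rw [le_div_iff₀ hua] at this
      push_cast
      linarith
  refine ⟨u, hu, fun t ht => ?_⟩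
  -- the ideal of the elements of value `> t` is `yM` with `y` of value `t`
  let I : Ideal R :=
    { carrier := {r | r ≠ 0 → t < u r}
      zero_mem' := fun h => absurd rfl h
      add_mem' := by
        intro a b ha hb hab
        by_cases ha0 : a = 0
        · rw [ha0, zero_add] at hab ⊢
          exact hb hab
        by_cases hb0 : b = 0
        · rw [hb0, add_zero] at hab ⊢
          exact ha hab
        rcases hu.le_map_add ha0 hb0 hab with h | h
        · exact (ha ha0).trans_le h
        · exact (hb hb0).trans_le h
      smul_mem' := by
        intro c a ha hca
        have ha0 := right_ne_zero_of_mul hca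
        exact (ha ha0).trans_le ((hu.dvd_iff a _ ha0 hca).1 (dvd_mul_left a c)) }
  have hmem : ∀ r, r ≠ 0 → t < u r → r ∈ I := fun r _ h _ => h
  obtain ⟨r₀, hr₀, htr₀, -⟩ := hdense t (t + 1) ht (by linarith)
  have hr₀I := hmem r₀ hr₀ htr₀
  rcases hM.eq_span_or I with ⟨z, hz⟩ | ⟨y, hy⟩
  · exfalso
    have hz0 : z ≠ 0 := by
      rintro rfl
      rw [hz] at hr₀I
      simp [hr₀] at hr₀I
    obtain ⟨r, hr, htr, hrz⟩ := hdense t (u z) ht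
      ((hz ▸ Ideal.mem_span_singleton_self z : z ∈ I) hz0)
    have := Ideal.mem_span_singleton.1 (hz ▸ hmem r hr htr)
    exact hrz.not_ge ((hu.dvd_iff z r hz0 hr).1 this)
  · have hy0 : y ≠ 0 := by
      rintro rfl
      rw [hy] at hr₀I
      simp [hr₀] at hr₀I
    refine ⟨y, hy0, le_antisymm (not_lt.1 fun h => ?_) (not_lt.1 fun h => ?_)⟩
    · obtain ⟨r, hr, htr, hry⟩ := hdense t (u y) ht h
      obtain ⟨m, -, rfl⟩ := Ideal.mem_span_singleton_mul.1 (hy ▸ hmem r hr htr)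
      exact hry.not_ge ((hu.dvd_iff y _ hy0 hr).1 (dvd_mul_right y m))
    · obtain ⟨r, hr, hyr, hrt⟩ := hdense (u y) t (hu.nonneg hy0) h
      obtain ⟨m, rfl⟩ := (hu.dvd_iff y r hy0 hr).2 hyr.le
      have hm0 := right_ne_zero_of_mul hr
      rw [hu.map_mul y m hy0 hm0] at hyr
      have hmM : m ∈ maximalIdeal R := (hpos m hm0).2 (by linarith)
      have : y * m ∈ I := hy ▸ Ideal.mul_mem_mul (Ideal.mem_span_singleton_self y) hmM
      exact (this hr).not_gt hrt

end IsPinchingIdeal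

/-- The three cases are: `Q` is not maximal, `Q` is maximal and finitely generated (or `R` is
principal), `Q` is maximal and not finitely generated. The cases appear in the order of the
conclusion as second, first and third. -/
theorem isTwoGenerated_and_isPVD_or {R : Type*} [CommRing R] [IsDomain R] [IsLocalRing R]
    (h : IsPrincipalIdealRing R ∨ ∃ Q : Ideal R, IsPinchingIdeal Q) :
    (IsTwoGenerated R ∧ IsPVD R) ∨ IsValuationDomainWithValueGroup R (ℤ ×ₗ ℤ) ∨
      IsValuationDomainWithValueGroup R ℝ := by
  rcases h with h | ⟨Q, hQ⟩
  · exact Or.inl ⟨isTwoGenerated_of_isPrincipalIdealRing, isPVD_of_valuationRing⟩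
  by_cases hQM : Q = maximalIdeal R
  swap
  · obtain ⟨u, hu⟩ := hQ.exists_isValueMap_lex hQM
    exact Or.inr (Or.inl hu.isValuationDomainWithValueGroup)
  subst hQM
  by_cases hfg : (maximalIdeal R).FG
  · exact Or.inl ⟨hQ.isTwoGenerated hfg, hQ.isPVD hfg⟩
  · obtain ⟨u, hu⟩ := hQ.exists_isValueMap_real hfg
    exact Or.inr (Or.inr hu.isValuationDomainWithValueGroup)

/-! ### Pinching ideals of the three kinds of local domains -/

/-- Write `M = cV` with `V = M : M`. Since `M` has two generators, `V = R + Rβ` for each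
`β ∈ V \ R`, so an ideal `(a, aβ)` equals `aV`, which is a multiple of `cV`. -/
theorem isPrincipalIdealRing_or_isPinchingIdeal_of_isPVD {R : Type*} [CommRing R] [IsDomain R]
    (h2 : IsTwoGenerated R) (hR : IsPVD R) :
    IsPrincipalIdealRing R ∨ ∃ Q : Ideal R, IsPinchingIdeal Q := by
  obtain ⟨_, hR⟩ := hR
  set φ := algebraMap R (FractionRing R)
  set M := maximalIdeal R
  set V := colonRing M
  obtain ⟨hval, N, hN, hNM⟩ := hR
  have hinj : Function.Injective (φ) := IsFractionRing.injective R (FractionRing R)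
  have hR0 : ∀ a : R, a ≠ 0 → φ a ≠ 0 := fun a ha => (map_ne_zero_iff φ hinj).2 ha
  have hRV : ∀ r : R, φ r ∈ V := algebraMap_mem_colonRing M
  have hdiv : ∀ a b : R, a ≠ 0 → b ≠ 0 → φ b / φ a ∈ V ∨
      φ a / φ b ∈ V := fun a b ha hb => by
    rcases ValuationRing.dvd_total (⟨_, hRV a⟩ : V) ⟨_, hRV b⟩ with ⟨c, hc⟩ | ⟨c, hc⟩
    · left
      have := congrArg Subtype.val hc
      change φ b = φ a * c at this
      rw [this, mul_div_cancel_left₀ _ (hR0 a ha)]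
      exact c.2
    · right
      have := congrArg Subtype.val hc
      change φ a = φ b * c at this
      rw [this, mul_div_cancel_left₀ _ (hR0 b hb)]
      exact c.2
  have hloc : ∀ v ∈ V, v ∉ idealImage M → v⁻¹ ∈ V := by
    intro v hv hvM
    have hvN : (⟨v, hv⟩ : V) ∉ N := fun h => hvM (hNM ▸ ⟨_, h, rfl⟩)
    have hVloc : IsLocalRing V := ValuationRing.isLocalRing V
    rw [eq_maximalIdeal hN, mem_maximalIdeal, mem_nonunits_iff, not_not] at hvN
    obtain ⟨w, hw⟩ := hvN.exists_right_inv
    have := congrArg Subtype.val hw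
    change v * w = 1 at this
    rw [inv_eq_of_mul_eq_one_right this]
    exact w.2
  have hpair : ∀ a b : R, a ≠ 0 → φ b / φ a ∈ V →
      (∃ z, Ideal.span {a, b} = Ideal.span {z}) ∨
        ∃ y, Ideal.span {a, b} = Ideal.span {y} * M := by
    intro a b ha hβ
    by_cases hβR : ∃ r, φ r = φ b / φ a
    · left
      obtain ⟨r, hr⟩ := hβR
      rw [eq_div_iff (hR0 a ha), ← map_mul] at hr
      refine ⟨a, le_antisymm (Ideal.span_le.2 ?_) (Ideal.span_mono (by simp))⟩
      rintro z (rfl | rfl)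
      · exact Ideal.mem_span_singleton_self _
      · exact Ideal.mem_span_singleton'.2 ⟨r, hinj hr⟩
    right
    have hb : b ≠ 0 := by
      rintro rfl
      exact hβR ⟨0, by simp⟩
    obtain ⟨c, d, hc, hM, hδ⟩ : ∃ c d, c ≠ 0 ∧ M = Ideal.span {c, d} ∧
        φ d / φ c ∈ V := by
      obtain ⟨c, d, hM⟩ := h2 M
      by_cases hc : c = 0
      · have hd : d ≠ 0 := by
          rintro rfl
          -- otherwise `R` is a field
          have hau : IsUnit a := by
            by_contra hau
            have : a ∈ M := hau
            rw [hM, hc] at this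
            simp [ha] at this
          obtain ⟨a', ha'⟩ := hau.exists_right_inv
          refine hβR ⟨b * a', ?_⟩
          rw [eq_div_iff (hR0 a ha), ← map_mul, mul_assoc, mul_comm a', ha', mul_one]
        exact ⟨d, c, hd, by rw [hM, Ideal.span_pair_comm], by
          rw [hc, map_zero, zero_div]
          exact V.zero_mem⟩
      by_cases hd : d = 0
      · exact ⟨c, d, hc, hM, by
          rw [hd, map_zero, zero_div]
          exact V.zero_mem⟩
      rcases hdiv c d hc hd with h | h
      · exact ⟨c, d, hc, hM, h⟩
      · exact ⟨d, c, hd, by rw [hM, Ideal.span_pair_comm], h⟩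
    have hcM : c ∈ M := hM ▸ Ideal.subset_span (by simp)
    have hMV : ∀ m ∈ M, φ m / φ c ∈ V := by
      intro m hm
      rw [hM, Ideal.mem_span_pair] at hm
      obtain ⟨r, s, rfl⟩ := hm
      rw [map_add, map_mul, map_mul, add_div, mul_div_cancel_right₀ _ (hR0 c hc), mul_div_assoc]
      exact V.add_mem (hRV r) (V.mul_mem (hRV s) hδ)
    have hVδ : ∀ v ∈ V, ∃ r s : R, v = φ r +
        φ s * (φ d / φ c) := by
      intro v hv
      obtain ⟨m, hm, h⟩ := hv _ ⟨c, hcM, rfl⟩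
      have hm' : m ∈ M := hm
      rw [hM, Ideal.mem_span_pair] at hm'
      obtain ⟨r, s, rfl⟩ := hm'
      refine ⟨r, s, mul_right_cancel₀ (hR0 c hc) ?_⟩
      rw [← h, map_add, map_mul, map_mul, add_mul, mul_assoc (φ s),
        div_mul_cancel₀ _ (hR0 c hc)]
    obtain ⟨r₀, s₀, hrs⟩ := hVδ _ hβ
    have hs₀ : IsUnit s₀ := by
      by_contra hs₀
      obtain ⟨m, hm, h⟩ := hδ _ ⟨s₀, hs₀, rfl⟩
      exact hβR ⟨r₀ + m, by rw [hrs, map_add, h, mul_comm (φ s₀)]⟩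
    obtain ⟨s₁, hs₁⟩ := hs₀.exists_right_inv
    have hVI : ∀ r : R, φ r / φ a ∈ V → r ∈ Ideal.span {a, b} := by
      intro r hr
      obtain ⟨p, q, hpq⟩ := hVδ _ hr
      rw [Ideal.mem_span_pair]
      refine ⟨p - q * s₁ * r₀, q * s₁, hinj ?_⟩
      have h1 : φ s₀ * φ s₁ = 1 := by rw [← map_mul, hs₁, map_one]
      have ha' := hR0 a ha
      rw [div_eq_iff ha'] at hpq hrs
      rw [hpq, map_add, map_mul, map_mul, map_sub, map_mul, map_mul, hrs]
      linear_combination (φ q * (φ d / φ c) *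
        φ a) * h1
    have haM : a ∈ M := fun hau => by
      obtain ⟨a', ha'⟩ := hau.exists_right_inv
      refine hβR ⟨b * a', ?_⟩
      rw [eq_div_iff (hR0 a ha), ← map_mul, mul_assoc, mul_comm a', ha', mul_one]
    by_cases hy : ∃ y, φ y = φ a / φ c
    · obtain ⟨y, hy⟩ := hy
      rw [eq_div_iff (hR0 c hc), ← map_mul] at hy
      obtain rfl := hinj hy
      refine ⟨y, le_antisymm (Ideal.span_le.2 ?_) ?_⟩
      · rintro z (rfl | rfl)
        · exact Ideal.mul_mem_mul (Ideal.mem_span_singleton_self y) hcM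
        · obtain ⟨m, hm, h⟩ := hβ _ ⟨c, hcM, rfl⟩
          refine Ideal.mem_span_singleton_mul.2 ⟨m, hm, hinj ?_⟩
          rw [map_mul, h, mul_left_comm, ← map_mul, div_mul_cancel₀ _ (hR0 _ ha)]
      · rw [Ideal.span_singleton_mul_le_iff]
        intro m hm
        refine hVI _ ?_
        rw [map_mul, map_mul, mul_div_mul_left _ _ (hR0 y (left_ne_zero_of_mul ha))]
        exact hMV m hm
    · refine ⟨1, ?_⟩
      rw [Ideal.span_singleton_one, Ideal.top_mul]
      have hinv := hloc _ (hMV a haM) fun ⟨m, _, h⟩ => hy ⟨m, h⟩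
      refine le_antisymm (Ideal.span_le.2 ?_) fun m hm => hVI m ?_
      · rintro z (rfl | rfl)
        · exact haM
        · obtain ⟨m, hm, h⟩ := hβ _ ⟨a, haM, rfl⟩
          rw [div_mul_cancel₀ _ (hR0 a ha)] at h
          rwa [← hinj h]
      · have := V.mul_mem (hMV m hm) hinv
        rwa [inv_div, div_mul_div_cancel₀ (hR0 c hc)] at this
  have hall : ∀ I : Ideal R, (∃ z, I = Ideal.span {z}) ∨ ∃ y, I = Ideal.span {y} * M := by
    intro I
    obtain ⟨a, b, rfl⟩ := h2 I
    by_cases ha : a = 0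
    · exact Or.inl ⟨b, by rw [ha, Ideal.span_insert_zero]⟩
    by_cases hb : b = 0
    · exact Or.inl ⟨a, by rw [hb, Ideal.span_pair_comm, Ideal.span_insert_zero]⟩
    rcases hdiv a b ha hb with h | h
    · exact hpair a b ha h
    · rw [Ideal.span_pair_comm]
      exact hpair b a hb h
  by_cases hM : ∃ c, M = Ideal.span {c}
  · obtain ⟨c, hc⟩ := hM
    refine Or.inl ⟨fun I => ?_⟩
    rcases hall I with ⟨z, hz⟩ | ⟨y, hy⟩
    · exact ⟨z, hz⟩
    · exact ⟨y * c, by rw [hy, hc, Ideal.span_singleton_mul_span_singleton]⟩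
  · exact Or.inr ⟨M, (maximalIdeal.isMaximal R).isPrime, fun a ha => hM ⟨a, ha⟩, hall⟩

/-- An element of minimal value generates the ideal. -/
theorem IsDivisibilityMap.eq_span_of_forall_le {R Γ : Type*} [CommRing R] [AddCommGroup Γ]
    [LinearOrder Γ] {u : R → Γ} (hu : IsDivisibilityMap u) {I : Ideal R} {z : R} (hz : z ∈ I)
    (hz0 : z ≠ 0)
    (h : ∀ r ∈ I, r ≠ 0 → u z ≤ u r) : I = Ideal.span {z} := by
  refine le_antisymm (fun r hr => Ideal.mem_span_singleton.2 ?_)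
    ((Ideal.span_singleton_le_iff_mem I).2 hz)
  by_cases hr0 : r = 0
  · exact hr0 ▸ dvd_zero z
  · exact (hu.dvd_iff z r hz0 hr0).2 (h r hr hr0)

section ValueMap

variable {R : Type*} [CommRing R] [IsDomain R]

/-- The pinching ideal consists of the elements whose value has positive first coordinate. If an
ideal has no element of minimal value and `n` is the least first coordinate of its values, then it
contains every element whose value has first coordinate at least `n`. -/
theorem IsValueMap.exists_isPinchingIdeal_lex {u : R → ℤ ×ₗ ℤ} (hu : IsValueMap u) :
    ∃ Q : Ideal R, IsPinchingIdeal Q := by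
  have hfst : ∀ a, a ≠ 0 → 0 ≤ (ofLex (u a)).1 := fun a ha => by
    rcases Prod.Lex.le_iff.1 (hu.nonneg ha) with h | h
    · exact h.le
    · exact h.1.le
  have hfmul : ∀ a b, a ≠ 0 → b ≠ 0 →
      (ofLex (u (a * b))).1 = (ofLex (u a)).1 + (ofLex (u b)).1 := fun a b ha hb => by
    rw [hu.map_mul a b ha hb, ofLex_add, Prod.fst_add]
  have hfdvd : ∀ a b, a ≠ 0 → b ≠ 0 → a ∣ b → (ofLex (u a)).1 ≤ (ofLex (u b)).1 := by
    rintro a b ha hb ⟨c, rfl⟩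
    have hc := right_ne_zero_of_mul hb
    rw [hfmul a c ha hc]
    linarith [hfst c hc]
  have hdvd : ∀ a b, a ≠ 0 → b ≠ 0 → (ofLex (u a)).1 < (ofLex (u b)).1 → a ∣ b :=
    fun a b ha hb h => (hu.dvd_iff a b ha hb).2 (Prod.Lex.le_iff.2 (Or.inl h))
  have hdvd' : ∀ a b, a ≠ 0 → b ≠ 0 → (ofLex (u a)).1 = (ofLex (u b)).1 →
      (ofLex (u a)).2 ≤ (ofLex (u b)).2 → a ∣ b :=
    fun a b ha hb h h' => (hu.dvd_iff a b ha hb).2 (Prod.Lex.le_iff.2 (Or.inr ⟨h, h'⟩))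
  let Q : Ideal R :=
    { carrier := {r | r ≠ 0 → 0 < (ofLex (u r)).1}
      zero_mem' := fun h => absurd rfl h
      add_mem' := by
        intro a b ha hb hab
        by_cases ha0 : a = 0
        · rw [ha0, zero_add] at hab ⊢
          exact hb hab
        by_cases hb0 : b = 0
        · rw [hb0, add_zero] at hab ⊢
          exact ha hab
        have := hu.valuationRing
        rcases ValuationRing.dvd_total a b with h | h
        · exact (ha ha0).trans_le (hfdvd _ _ ha0 hab (dvd_add dvd_rfl h))
        · exact (hb hb0).trans_le (hfdvd _ _ hb0 hab (dvd_add h dvd_rfl))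
      smul_mem' := by
        intro c a ha hca
        have ha0 := right_ne_zero_of_mul hca
        exact (ha ha0).trans_le (hfdvd _ _ ha0 hca (dvd_mul_left a c)) }
  have hQ : ∀ r, r ≠ 0 → (r ∈ Q ↔ 0 < (ofLex (u r)).1) := fun r hr =>
    ⟨fun h => h hr, fun h _ => h⟩
  refine ⟨Q, ⟨?_, ?_⟩, ?_, ?_⟩
  · rw [Ne, Ideal.eq_top_iff_one, hQ 1 one_ne_zero, hu.map_one]
    simp
  · intro a b hab
    by_cases ha : a = 0
    · exact Or.inl (ha ▸ Q.zero_mem)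
    by_cases hb : b = 0
    · exact Or.inr (hb ▸ Q.zero_mem)
    rw [hQ _ (mul_ne_zero ha hb), hfmul a b ha hb] at hab
    rw [hQ a ha, hQ b hb]
    by_contra! h
    linarith
  · intro z hz
    obtain ⟨r₁, hr₁, hur₁⟩ := hu.surj (toLex (1, 0)) (Prod.Lex.le_iff.2 (Or.inl (by simp)))
    have hr₁Q : r₁ ∈ Q := (hQ r₁ hr₁).2 (by rw [hur₁]; simp)
    have hz0 : z ≠ 0 := by
      rintro rfl
      rw [hz] at hr₁Q
      simp [hr₁] at hr₁Q
    have huz : 0 < (ofLex (u z)).1 := (hQ z hz0).1 (hz ▸ Ideal.mem_span_singleton_self z)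
    obtain ⟨r, hr, hur⟩ := hu.surj (toLex ((ofLex (u z)).1, (ofLex (u z)).2 - 1))
      (Prod.Lex.le_iff.2 (Or.inl huz))
    have hrQ : r ∈ Q := (hQ r hr).2 (by rw [hur]; exact huz)
    rw [hz, Ideal.mem_span_singleton, hu.dvd_iff z r hz0 hr, hur, Prod.Lex.le_iff] at hrQ
    simp at hrQ
  · intro I
    by_cases hI : I = ⊥
    · exact Or.inl ⟨0, by simp [hI]⟩
    have hex : ∃ n : ℕ, ∃ r ∈ I, r ≠ 0 ∧ (ofLex (u r)).1 = n := by
      obtain ⟨r, hr, hr0⟩ := Submodule.exists_mem_ne_zero_of_ne_bot hI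
      exact ⟨(ofLex (u r)).1.toNat, r, hr, hr0, (Int.toNat_of_nonneg (hfst r hr0)).symm⟩
    classical
    obtain ⟨n, ⟨r₀, hr₀, hr₀0, hn⟩, hmin⟩ : ∃ n : ℕ,
        (∃ r ∈ I, r ≠ 0 ∧ (ofLex (u r)).1 = n) ∧ ∀ r ∈ I, r ≠ 0 → (n : ℤ) ≤ (ofLex (u r)).1 := by
      refine ⟨Nat.find hex, Nat.find_spec hex, fun r hr hr0 => ?_⟩
      have := Nat.find_min' hex ⟨r, hr, hr0, (Int.toNat_of_nonneg (hfst r hr0)).symm⟩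
      have := hfst r hr0
      omega
    by_cases hbdd : ∃ m : ℤ, ∀ k : ℤ, (∃ r ∈ I, r ≠ 0 ∧ (ofLex (u r)).1 = n ∧
        (ofLex (u r)).2 = k) → m ≤ k
    · left
      obtain ⟨k, ⟨z, hz, hz0, hzn, hzk⟩, hk⟩ :=
        Int.exists_least_of_bdd hbdd ⟨_, r₀, hr₀, hr₀0, hn, rfl⟩
      refine ⟨z, hu.eq_span_of_forall_le hz hz0 fun r hr hr0 => Prod.Lex.le_iff.2 ?_⟩
      rcases (hmin r hr hr0).lt_or_eq with h | h
      · exact Or.inl (hzn ▸ h)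
      · exact Or.inr ⟨hzn.trans h, hzk ▸ hk _ ⟨r, hr, hr0, h.symm, rfl⟩⟩
    · right
      push Not at hbdd
      have hn0 : n ≠ 0 := by
        rintro rfl
        obtain ⟨k, ⟨r, hr, hr0, hr1, hrk⟩, hk⟩ := hbdd 0
        rcases Prod.Lex.le_iff.1 (hu.nonneg hr0) with h | h
        · exact h.ne hr1.symm
        · exact (hrk ▸ h.2).not_gt hk
      obtain ⟨y, hy0, hy⟩ := hu.surj (toLex ((n : ℤ) - 1, 0)) (Prod.Lex.le_iff.2 (by
        rcases Nat.lt_or_ge 1 n with h | h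
        · left
          simpa using h
        · right
          obtain rfl : n = 1 := by omega
          simp))
      have hy1 : (ofLex (u y)).1 = n - 1 := by rw [hy]; rfl
      refine ⟨y, le_antisymm (fun r hr => ?_) (Ideal.span_singleton_mul_le_iff.2 fun q hq => ?_)⟩
      · by_cases hr0 : r = 0
        · exact hr0 ▸ Ideal.zero_mem _
        have hrn := hmin r hr hr0
        obtain ⟨q, rfl⟩ := hdvd y r hy0 hr0 (by omega)
        have hq0 := right_ne_zero_of_mul hr0
        rw [hfmul y q hy0 hq0] at hrn
        exact Ideal.mul_mem_mul (Ideal.mem_span_singleton_self y) ((hQ q hq0).2 (by omega))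
      · by_cases hq0 : q = 0
        · rw [hq0, mul_zero]
          exact I.zero_mem
        have hyq0 := mul_ne_zero hy0 hq0
        obtain ⟨k, ⟨r, hr, hr0, hr1, hrk⟩, hk⟩ := hbdd (ofLex (u (y * q))).2
        have h1 := hfmul y q hy0 hq0
        have h2 := (hQ q hq0).1 hq
        refine I.mem_of_dvd ?_ hr
        rcases lt_or_eq_of_le (show (ofLex (u r)).1 ≤ (ofLex (u (y * q))).1 by omega) with h | h
        · exact hdvd _ _ hr0 hyq0 h
        · exact hdvd' _ _ hr0 hyq0 h (by omega)

theorem IsValueMap.exists_isPinchingIdeal_real {u : R → ℝ} (hu : IsValueMap u) :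
    ∃ Q : Ideal R, IsPinchingIdeal Q := by
  have := hu.valuationRing
  have hQ : ∀ r, r ≠ 0 → (r ∈ maximalIdeal R ↔ 0 < u r) := fun r hr => by
    rw [mem_maximalIdeal, mem_nonunits_iff, hu.isUnit_iff hr, (hu.nonneg hr).lt_iff_ne, ne_comm]
  refine ⟨maximalIdeal R, (maximalIdeal.isMaximal R).isPrime, fun z hz => ?_, fun I => ?_⟩
  · obtain ⟨r₁, hr₁, hur₁⟩ := hu.surj 1 zero_le_one
    have hr₁Q : r₁ ∈ maximalIdeal R := (hQ r₁ hr₁).2 (by rw [hur₁]; exact one_pos)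
    have hz0 : z ≠ 0 := by
      rintro rfl
      rw [hz] at hr₁Q
      simp [hr₁] at hr₁Q
    have huz : 0 < u z := (hQ z hz0).1 (hz ▸ Ideal.mem_span_singleton_self z)
    obtain ⟨r, hr, hur⟩ := hu.surj (u z / 2) (half_pos huz).le
    have hrQ : r ∈ maximalIdeal R := (hQ r hr).2 (by rw [hur]; exact half_pos huz)
    rw [hz, Ideal.mem_span_singleton, hu.dvd_iff z r hz0 hr, hur] at hrQ
    linarith
  · by_cases hI : I = ⊥
    · exact Or.inl ⟨0, by simp [hI]⟩
    set S : Set ℝ := {t | ∃ r ∈ I, r ≠ 0 ∧ u r = t} with hS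
    have hne : S.Nonempty := by
      obtain ⟨r, hr, hr0⟩ := Submodule.exists_mem_ne_zero_of_ne_bot hI
      exact ⟨u r, r, hr, hr0, rfl⟩
    have hbdd : BddBelow S := ⟨0, by
      rintro _ ⟨r, -, hr0, rfl⟩
      exact hu.nonneg hr0⟩
    by_cases hatt : sInf S ∈ S
    · obtain ⟨z, hz, hz0, hzS⟩ := hatt
      exact Or.inl ⟨z, hu.eq_span_of_forall_le hz hz0 fun r hr hr0 =>
        hzS ▸ csInf_le hbdd ⟨r, hr, hr0, rfl⟩⟩
    · right
      obtain ⟨y, hy0, hy⟩ := hu.surj (sInf S) (le_csInf hne (by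
        rintro _ ⟨r, -, hr0, rfl⟩
        exact hu.nonneg hr0))
      refine ⟨y, le_antisymm (fun r hr => ?_) (Ideal.span_singleton_mul_le_iff.2 fun q hq => ?_)⟩
      · by_cases hr0 : r = 0
        · exact hr0 ▸ Ideal.zero_mem _
        have hlt : u y < u r := by
          rw [hy]
          refine lt_of_le_of_ne (csInf_le hbdd ⟨r, hr, hr0, rfl⟩) fun h => hatt ?_
          exact ⟨r, hr, hr0, h.symm⟩
        obtain ⟨q, rfl⟩ := (hu.dvd_iff y r hy0 hr0).2 hlt.le
        have hq0 := right_ne_zero_of_mul hr0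
        rw [hu.map_mul y q hy0 hq0] at hlt
        exact Ideal.mul_mem_mul (Ideal.mem_span_singleton_self y) ((hQ q hq0).2 (by linarith))
      · by_cases hq0 : q = 0
        · rw [hq0, mul_zero]
          exact I.zero_mem
        have hyq0 := mul_ne_zero hy0 hq0
        have h1 := hu.map_mul y q hy0 hq0
        have h2 := (hQ q hq0).1 hq
        obtain ⟨_, ⟨r, hr, hr0, rfl⟩, hlt⟩ := exists_lt_of_csInf_lt hne
          (show sInf S < u (y * q) by linarith)
        exact I.mem_of_dvd ((hu.dvd_iff _ _ hr0 hyq0).2 hlt.le) hr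

end ValueMap

theorem isPrincipalIdealRing_or_isPinchingIdeal {R : Type*} [CommRing R] [IsDomain R]
    (h : (IsTwoGenerated R ∧ IsPVD R) ∨ IsValuationDomainWithValueGroup R (ℤ ×ₗ ℤ) ∨
      IsValuationDomainWithValueGroup R ℝ) :
    IsPrincipalIdealRing R ∨ ∃ Q : Ideal R, IsPinchingIdeal Q := by
  rcases h with h | h | h
  · exact isPrincipalIdealRing_or_isPinchingIdeal_of_isPVD h.1 h.2
  · obtain ⟨u, hu⟩ := h.exists_isValueMap
    exact Or.inr hu.exists_isPinchingIdeal_lex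
  · obtain ⟨u, hu⟩ := h.exists_isValueMap
    exact Or.inr hu.exists_isPinchingIdeal_real

/-! ### Factorization in h-local domains -/

section HLocal

variable {D : Type*} [CommRing D]

theorem map_localContraction {M : Ideal D} [M.IsPrime] (I : Ideal D) :
    (localContraction M I).map (algebraMap D (Localization.AtPrime M)) =
      I.map (algebraMap D (Localization.AtPrime M)) :=
  IsLocalization.map_under M.primeCompl _ _

theorem localContraction_eq_top {M I : Ideal D} [M.IsPrime] (h : ¬ I ≤ M) :
    localContraction M I = ⊤ := by
  obtain ⟨s, hs, hsM⟩ := SetLike.not_le_iff_exists.1 h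
  exact (Ideal.eq_top_iff_one _).2 (mem_localContraction.2 ⟨s, hsM, by rwa [mul_one]⟩)

/-- Every ideal is the intersection of its contractions from the localizations at the maximal
ideals that contain it. -/
theorem iInf_localContraction (I : Ideal D) {s : Finset (MaximalSpectrum D)}
    (hs : ∀ M : MaximalSpectrum D, I ≤ M.asIdeal → M ∈ s) :
    ⨅ M ∈ s, localContraction M.asIdeal I = I := by
  refine le_antisymm (fun x hx => ?_) (le_iInf₂ fun M _ => le_localContraction)
  simp only [Ideal.mem_iInf] at hx
  have htop : I.colon {x} = ⊤ := by
    by_contra hne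
    obtain ⟨M, hM, hle⟩ := Ideal.exists_le_maximal _ hne
    have hIM : I ≤ M := fun i hi => hle (by
      rw [Submodule.mem_colon_singleton, smul_eq_mul]
      exact I.mul_mem_right x hi)
    obtain ⟨t, ht, htx⟩ := mem_localContraction.1 (hx ⟨M, hM⟩ (hs ⟨M, hM⟩ hIM))
    exact ht (hle (by rwa [Submodule.mem_colon_singleton, smul_eq_mul]))
  have := (Ideal.eq_top_iff_one _).1 htop
  rwa [Submodule.mem_colon_singleton, one_smul] at this

theorem exists_span_eq_map_span {M : Ideal D} [M.IsPrime] (z : Localization.AtPrime M) :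
    ∃ y : D, Ideal.span {z} = (Ideal.span {y}).map (algebraMap D (Localization.AtPrime M)) := by
  obtain ⟨y, t, rfl⟩ := IsLocalization.exists_mk'_eq M.primeCompl z
  refine ⟨y, ?_⟩
  rw [Ideal.map_span, Set.image_singleton]
  have hu : IsUnit (algebraMap D (Localization.AtPrime M) t) := IsLocalization.map_units _ t
  rw [← IsLocalization.mk'_spec (Localization.AtPrime M) y t,
    Ideal.span_singleton_mul_right_unit hu]

namespace IsHLocal

variable (h : IsHLocal D)
include h

theorem eq_of_localContraction_le {M N I : Ideal D} [hM : M.IsMaximal] (hN : N.IsMaximal)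
    (hI : I ≠ ⊥) (hle : localContraction M I ≤ N) : M = N := by
  by_contra hMN
  exact localContraction_not_le h.2 hMN hI hle

theorem eq_prod_localContraction {I : Ideal D} (hI : I ≠ ⊥) {s : Finset (MaximalSpectrum D)}
    (hs : ∀ M : MaximalSpectrum D, I ≤ M.asIdeal → M ∈ s) :
    I = ∏ M ∈ s, localContraction M.asIdeal I := by
  rw [Ideal.prod_eq_iInf_of_pairwise_isCoprime, iInf_localContraction I hs]
  intro M _ N _ hMN
  rw [Function.onFun, Ideal.isCoprime_iff_sup_eq]
  by_contra hne
  obtain ⟨L, hL, hle⟩ := Ideal.exists_le_maximal _ hne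
  have h1 := h.eq_of_localContraction_le hL hI (le_sup_left.trans hle)
  have h2 := h.eq_of_localContraction_le hL hI (le_sup_right.trans hle)
  exact hMN (MaximalSpectrum.ext (h1.trans h2.symm))

theorem exists_finset {I : Ideal D} (hI : I ≠ ⊥) :
    ∃ s : Finset (MaximalSpectrum D), ∀ M : MaximalSpectrum D, M ∈ s ↔ I ≤ M.asIdeal := by
  have hfin : {M : MaximalSpectrum D | I ≤ M.asIdeal}.Finite :=
    Set.Finite.of_injOn (t := {M : Ideal D | M.IsMaximal ∧ I ≤ M})
      (f := MaximalSpectrum.asIdeal) (fun M hM => ⟨M.isMaximal, hM⟩)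
      (fun M _ N _ h => MaximalSpectrum.ext h) (h.1 I hI)
  exact ⟨hfin.toFinset, fun M => by simp⟩

/-- Both sides lie in no maximal ideal other than `M`, and they agree in `D_M`. -/
theorem localContraction_mul {M A B : Ideal D} [hM : M.IsMaximal] (hA : A ≠ ⊥) (hB : B ≠ ⊥)
    (hAB : A * B ≠ ⊥) :
    localContraction M (A * B) = localContraction M A * localContraction M B := by
  set C := localContraction M A * localContraction M B with hC
  have hABC : A * B ≤ C := Ideal.mul_mono le_localContraction le_localContraction
  have hC0 : C ≠ ⊥ := ne_bot_of_le_ne_bot hAB hABC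
  have hs : ∀ N : MaximalSpectrum D, C ≤ N.asIdeal → 
      N ∈ ({⟨M, hM⟩} : Finset (MaximalSpectrum D)) := fun N hN => by
    rw [Finset.mem_singleton]
    refine MaximalSpectrum.ext (Eq.symm ?_)
    rcases N.isMaximal.isPrime.mul_le.1 hN with h' | h'
    · exact h.eq_of_localContraction_le N.isMaximal hA h'
    · exact h.eq_of_localContraction_le N.isMaximal hB h'
  have h1 := h.eq_prod_localContraction hC0 hs
  rw [Finset.prod_singleton] at h1
  rw [h1, localContraction, localContraction, hC, Ideal.map_mul, Ideal.map_mul,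
    map_localContraction, map_localContraction]

variable [IsDomain D]

/-- `x D_M ∩ D` is a factor of the principal ideal `(x)`. -/
theorem isInvertibleIdeal_localContraction {M : Ideal D} [hM : M.IsMaximal] {x : D}
    (hx : x ≠ 0) : IsInvertibleIdeal (localContraction M (Ideal.span {x})) := by
  classical
  have hx' : Ideal.span {x} ≠ ⊥ := by simpa using hx
  obtain ⟨s, hs⟩ := h.exists_finset hx'
  have h1 := h.eq_prod_localContraction hx' (s := insert ⟨M, hM⟩ s)
    fun N hN => Finset.mem_insert_of_mem ((hs N).2 hN)
  rw [← Finset.mul_prod_erase _ _ (Finset.mem_insert_self _ s)] at h1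
  exact IsInvertibleIdeal.of_mul_eq_span hx h1.symm

theorem isInvertibleIdeal_localContraction_of_map_eq_span {M : Ideal D} [hM : M.IsMaximal]
    {I : Ideal D} (hI : I ≠ ⊥) {z : Localization.AtPrime M}
    (hz : I.map (algebraMap D (Localization.AtPrime M)) = Ideal.span {z}) :
    IsInvertibleIdeal (localContraction M I) := by
  obtain ⟨y, hy⟩ := exists_span_eq_map_span z
  have hIy : localContraction M I = localContraction M (Ideal.span {y}) := by
    rw [localContraction, hz, hy]
    rfl
  rw [hIy]
  refine h.isInvertibleIdeal_localContraction ?_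
  rintro rfl
  refine hI ?_
  rw [← Ideal.map_eq_bot_iff_of_injective (FaithfulSMul.algebraMap_injective D
    (Localization.AtPrime M)), hz, hy]
  simp

/-- The contraction of a pinching ideal of `D_M` is an MNI ideal of `D`. -/
theorem isMNI_comap {M : Ideal D} [hM : M.IsMaximal] {Q : Ideal (Localization.AtPrime M)}
    (hQ : IsPinchingIdeal Q) : IsMNI (Q.comap (algebraMap D (Localization.AtPrime M))) := by
  set P := Q.comap (algebraMap D (Localization.AtPrime M)) with hP
  have hPQ : P.map (algebraMap D (Localization.AtPrime M)) = Q :=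
    IsLocalization.map_under M.primeCompl _ Q
  have hPc : localContraction M P = P := by rw [localContraction, hPQ]
  have hP0 : P ≠ ⊥ := fun h0 => hQ.ne_bot (by rw [← hPQ, h0, Ideal.map_bot])
  refine ⟨⟨hP0, fun hPi => ?_⟩, fun B hB hPB => ?_⟩
  · obtain ⟨a, -, ha⟩ := (hPi.map (R := Localization.AtPrime M)).exists_eq_span
    exact hQ.ne_span a (hPQ ▸ ha)
  · by_contra hBP
    have hQB : Q < B.map (algebraMap D (Localization.AtPrime M)) := by
      refine lt_of_le_of_ne (hPQ.ge.trans (Ideal.map_mono hPB)) fun heq => hBP ?_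
      rw [hP, heq]
      exact Ideal.le_comap_map
    obtain ⟨z, hz⟩ := hQ.exists_eq_span_of_lt hQB
    have hBc : B = localContraction M B := by
      have := h.eq_prod_localContraction hB.1 (s := {⟨M, hM⟩}) fun N hN => by
        rw [Finset.mem_singleton]
        exact MaximalSpectrum.ext
          (h.eq_of_localContraction_le N.isMaximal hP0 (hPc.le.trans (hPB.trans hN))).symm
      rwa [Finset.prod_singleton] at this
    refine hB.2 ?_
    rw [hBc]
    exact h.isInvertibleIdeal_localContraction_of_map_eq_span hB.1 hz

/-- The factorization of the contraction of `I` from `D_M`. The set `T` of MNI factors has at most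
one element. -/
theorem exists_localContraction_eq_mul_prod {M : Ideal D} [hM : M.IsMaximal]
    (hloc : IsPrincipalIdealRing (Localization.AtPrime M) ∨
      ∃ Q : Ideal (Localization.AtPrime M), IsPinchingIdeal Q)
    {I : Ideal D} (hI : I ≠ ⊥) :
    ∃ (J : Ideal D) (T : Finset (Ideal D)), IsInvertibleIdeal J ∧
      (∀ P ∈ T, IsMNI P ∧ P ≤ M ∧ localContraction M P = P) ∧
        localContraction M I = J * ∏ P ∈ T, P := by
  have hprinc : (∃ z, I.map (algebraMap D (Localization.AtPrime M)) = Ideal.span {z}) →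
      ∃ (J : Ideal D) (T : Finset (Ideal D)), IsInvertibleIdeal J ∧
        (∀ P ∈ T, IsMNI P ∧ P ≤ M ∧ localContraction M P = P) ∧
          localContraction M I = J * ∏ P ∈ T, P := by
    rintro ⟨z, hz⟩
    exact ⟨_, ∅, h.isInvertibleIdeal_localContraction_of_map_eq_span hI hz, by simp, by simp⟩
  rcases hloc with hloc | ⟨Q, hQ⟩
  · exact hprinc ((hloc.principal (I.map (algebraMap D (Localization.AtPrime M)))).principal)
  rcases hQ.eq_span_or (I.map (algebraMap D (Localization.AtPrime M))) with hz | ⟨z, hz⟩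
  · exact hprinc hz
  set P := Q.comap (algebraMap D (Localization.AtPrime M)) with hP
  have hPQ : P.map (algebraMap D (Localization.AtPrime M)) = Q :=
    IsLocalization.map_under M.primeCompl _ Q
  have hPc : localContraction M P = P := by rw [localContraction, hPQ]
  have hPMNI : IsMNI P := h.isMNI_comap hQ
  obtain ⟨y, hy⟩ := exists_span_eq_map_span z
  have hy0 : y ≠ 0 := by
    rintro rfl
    refine hI ?_
    rw [← Ideal.map_eq_bot_iff_of_injective (FaithfulSMul.algebraMap_injective D
      (Localization.AtPrime M)), hz, hy]
    simp
  have hy' : Ideal.span {y} ≠ ⊥ := by simpa using hy0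
  refine ⟨localContraction M (Ideal.span {y}), {P}, h.isInvertibleIdeal_localContraction hy0,
    ?_, ?_⟩
  · simp only [Finset.mem_singleton, forall_eq]
    refine ⟨hPMNI, ?_, hPc⟩
    intro x hx
    by_contra hxM
    exact hPMNI.isPrime.ne_top (hPc ▸ localContraction_eq_top fun hle => hxM (hle hx))
  · rw [Finset.prod_singleton]
    conv_rhs => rw [← hPc]
    rw [← h.localContraction_mul hy' hPMNI.ne_bot (mul_ne_zero hy' hPMNI.ne_bot),
      localContraction, hz, hy, localContraction, Ideal.map_mul, hPQ]

theorem hasMNIFactorization (hloc : ∀ (M : Ideal D) [M.IsMaximal],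
    IsPrincipalIdealRing (Localization.AtPrime M) ∨
      ∃ Q : Ideal (Localization.AtPrime M), IsPinchingIdeal Q) : HasMNIFactorization D := by
  classical
  intro I hI _
  obtain ⟨s, hs⟩ := h.exists_finset hI
  choose J T hJ hT hIM using fun M : MaximalSpectrum D =>
    h.exists_localContraction_eq_mul_prod (hM := M.isMaximal) (@hloc M.asIdeal M.isMaximal) hI
  refine ⟨∏ M ∈ s, J M, s.biUnion T, isInvertibleIdeal_prod s J fun M _ => hJ M, ?_, ?_⟩
  · intro P hP
    obtain ⟨M, -, hPM⟩ := Finset.mem_biUnion.1 hP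
    exact (hT M P hPM).1
  · rw [Finset.prod_biUnion, ← Finset.prod_mul_distrib]
    · exact (h.eq_prod_localContraction hI fun M => (hs M).2).trans
        (Finset.prod_congr rfl fun M _ => hIM M)
    · intro M _ N _ hMN
      refine Finset.disjoint_left.2 fun P hPM hPN => hMN ?_
      have := M.isMaximal
      exact MaximalSpectrum.ext (h.eq_of_localContraction_le N.isMaximal (hT M P hPM).1.ne_bot
        ((hT M P hPM).2.2.le.trans (hT N P hPN).2.1))

end IsHLocal
end HLocal

theorem HasMNIFactorization.isPrincipalIdealRing_or_isPinchingIdeal {D : Type*} [CommRing D]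
    [IsDomain D] (h : HasMNIFactorization D) (M : Ideal D) [M.IsMaximal] :
    IsPrincipalIdealRing (Localization.AtPrime M) ∨
      ∃ Q : Ideal (Localization.AtPrime M), IsPinchingIdeal Q := by
  rcases h.isPrincipalIdealRing_localization_or M with h | ⟨Q, hQ, hall⟩
  · exact Or.inl h
  by_cases hprinc : ∃ a, Q = Ideal.span {a}
  · obtain ⟨a, ha⟩ := hprinc
    refine Or.inl ⟨fun I => ?_⟩
    rcases hall I with ⟨z, hz⟩ | ⟨y, hy⟩
    · exact ⟨z, hz⟩
    · exact ⟨y * a, by rw [hy, ha, Ideal.span_singleton_mul_span_singleton]⟩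
  · exact Or.inr ⟨Q, hQ, fun a ha => hprinc ⟨a, ha⟩, hall⟩

theorem theorem3 (D : Type*) [CommRing D] [IsDomain D] :
    IsGMPD D ↔
      ∀ I : Ideal D, I ≠ ⊥ → ¬ IsInvertibleIdeal I →
        ∃ (J : Ideal D) (k : ℕ) (P : Fin k → Ideal D),
          IsInvertibleIdeal J ∧ Function.Injective P ∧ (∀ i, IsMNI (P i)) ∧
            I = J * ∏ i, P i := by
  rw [← hasMNIFactorization_iff]
  constructor
  · rintro ⟨hD, hloc⟩
    exact hD.hasMNIFactorization fun M _ => isPrincipalIdealRing_or_isPinchingIdeal (hloc M)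
  · intro h
    exact ⟨h.isHLocal, fun M _ =>
      isTwoGenerated_and_isPVD_or (h.isPrincipalIdealRing_or_isPinchingIdeal M)⟩
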